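/- All manifolds are real, smooth, finite-dimensional, Hausdorff, second countable and connected, and all maps are smooth. Let $\pi:Y\to X$ be a fibred manifold (a surjective submersion), $\dim X=n$, with fibred coordinates $(x^\lambda,y^i)$ and $\omega=dx^1\wedge\dots\wedge dx^n$, $\omega_\lambda=\partial_\lambda\rfloor\omega$. Let $J^1Y$ be its first order jet manifold, with coordinates $(x^\lambda,y^i,y^i_\lambda)$, and let $\Pi=\bigwedge^nT^*X\otimes_Y TX\otimes_Y V^*Y$ be its Legendre manifold, with coordinates $(x^\lambda,y^i,p^\lambda_i)$ and projection $\pi_{\Pi Y}:\Pi\to Y$. Let $L=\mathcal L(x^\lambda,y^i,y^i_\lambda)\,\omega$ be a Lagrangian density on $J^1Y$, let $\widehat L:J^1Y\to\Pi$, $p^\lambda_i\circ\widehat L=\partial^\lambda_i\mathcal L:=\partial\mathcal L/\partial y^i_\lambda$, be its Legendre morphism and $Q=\widehat L(J^1Y)$ the constraint space. Assume that $L$ is semiregular: for every $q\in Q$ the preimage $\widehat L^{-1}(q)$ is a connected submanifold of $J^1Y$. Let $H$ be a Hamiltonian form on $\Pi$, that is, an exterior $n$-form such that near each point of $\Pi$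 there is a jet field $\gamma=dx^\lambda\otimes(\partial_\lambda+\gamma^i_{(\lambda)}\partial_i+\gamma^\mu_{i\lambda}\,\partial/\partial p^\mu_i)$ with $$dH=dp^\lambda_i\wedge dy^i\wedge\omega_\lambda+\gamma^\lambda_{i\lambda}\,dy^i\wedge\omega-\gamma^i_{(\lambda)}\,dp^\lambda_i\wedge\omega .$$ Locally and modulo closed forms, $H=p^\lambda_i\,dy^i\wedge\omega_\lambda-\mathcal H\omega$ with a function $\mathcal H(x^\lambda,y^i,p^\lambda_i)$, and $H$ defines the momentum morphism $\widehat H:\Pi\to J^1Y$ over $Y$ by $y^i_\lambda\circ\widehat H=\partial\mathcal H/\partial p^\lambda_i$. Assume that $H$ is associated with $L$: $\widehat L\circ\widehat H|_Q=\mathrm{Id}_Q$ and, modulo closed forms, $$H=p^\lambda_i\,dy^i\wedge\omega_\lambda-\bigl(p^\lambda_i\,(y^i_\lambda\circ\widehat H)-\mathcal L\circ\widehat H\bigr)\omega .$$ Sections are taken over an arbitrary open subset $U\subseteq X$ (for instance $U=X$). (i) Let $r$ be a section of $\Pi\to X$ that solves the Hamilton equations $\partial_\lambda r^i=\partial\mathcal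 H/\partial p^\lambda_i$, $\partial_\lambda r^\lambda_i=-\partial_i\mathcal H$ and takes its values in $Q$. Then the section $\overline s=\widehat H\circ r$ of $J^1Y\to X$ solves the first order Euler–Lagrange equations $$\partial_\lambda\overline s^i=\overline s^i_\lambda,\qquad \partial_i\mathcal L-(\partial_\lambda+\overline s^j_\lambda\partial_j+\partial_\lambda\overline s^j_\mu\,\partial^\mu_j)\,\partial^\lambda_i\mathcal L=0 .$$ (ii) Conversely, let $\overline s$ be a section of $J^1Y\to X$ that solves the first order Euler–Lagrange equations and satisfies $\widehat H\circ\widehat L\circ\overline s=\overline s$. Then the section $r=\widehat L\circ\overline s$ of $\Pi\to X$ solves the Hamilton equations for $H$ and takes its values in $Q$. (iii) For all sections $r$ and $\overline s$ as in (i) or as in (ii), $\overline s=J^1s$ with $s=\pi_{\Pi Y}\circ r$, and $s$ solves the second order Euler–Lagrange equations $$\partial_i\mathcal L-(\partial_\lambda+\partial_\lambda s^j\,\partial_j+\partial_\lambda\partial_\mu s^j\,\partial^\mu_j)\,\partial^\lambda_i\mathcal L=0\quad\text{at }(x^\lambda,s^i,\partial_\lambda s^i).$$ -/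

import Mathlib

open scoped Manifold ContDiff

noncomputable section

namespace Multimomentum

/-! ### Coordinate spaces and coordinate forms -/

/-- The coordinates `(x^λ, y^i, y^i_λ)` of a jet, or the coordinates `(x^λ, y^i, p^λ_i)` of a point
of the Legendre manifold.  The last component is indexed by `λ` first and by `i` second. -/
abbrev Coords (n m : ℕ) : Type := (Fin n → ℝ) × (Fin m → ℝ) × (Fin n → Fin m → ℝ)

/-- The volume form `dx^1 ∧ ... ∧ dx^n` of the coordinate space of the base. -/
def stdVol (n : ℕ) : (Fin n → ℝ) [⋀^Fin n]→L[ℝ] ℝ :=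
  { (Matrix.detRowAlternating : (Fin n → ℝ) [⋀^Fin n]→ₗ[ℝ] ℝ) with
    cont := Continuous.matrix_det continuous_id }

/-- The wedge product `α ∧ β` of a `1`-form and a `k`-form on a normed space:
`(α ∧ β)(v_0, ..., v_k) = ∑_j (-1)^j α(v_j) β(v_0, ..., v̂_j, ..., v_k)`. -/
def wedge {V : Type*} [NormedAddCommGroup V] [NormedSpace ℝ V] {k : ℕ} (α : V →L[ℝ] ℝ)
    (β : V [⋀^Fin k]→L[ℝ] ℝ) : V [⋀^Fin (k + 1)]→L[ℝ] ℝ :=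
  ContinuousAlternatingMap.alternatizeUncurryFin (α.smulRight β)

theorem wedge_apply {V : Type*} [NormedAddCommGroup V] [NormedSpace ℝ V] {k : ℕ} (α : V →L[ℝ] ℝ)
    (β : V [⋀^Fin k]→L[ℝ] ℝ) (v : Fin (k + 1) → V) :
    wedge α β v = ∑ j : Fin (k + 1), (-1) ^ (j : ℕ) * (α (v j) * β (j.removeNth v)) := by
  simp [wedge, ContinuousAlternatingMap.alternatizeUncurryFin_apply]

section CoordinateForms

variable {n m : ℕ}

/-- The coordinate vector `∂_λ`. -/
def eX (l : Fin n) : Coords n m := (Pi.single l 1, 0, 0)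

/-- The coordinate vector `∂_i`. -/
def eY (i : Fin m) : Coords n m := (0, Pi.single i 1, 0)

/-- The coordinate vector `∂/∂y^i_λ` or `∂/∂p^λ_i`. -/
def eP (l : Fin n) (i : Fin m) : Coords n m := (0, 0, Pi.single l (Pi.single i 1))

/-- The `1`-form `dy^i`. -/
def dY (i : Fin m) : Coords n m →L[ℝ] ℝ :=
  (ContinuousLinearMap.proj (R := ℝ) (φ := fun _ : Fin m => ℝ) i).comp
    ((ContinuousLinearMap.fst ℝ (Fin m → ℝ) (Fin n → Fin m → ℝ)).comp
      (ContinuousLinearMap.snd ℝ (Fin n → ℝ) ((Fin m → ℝ) × (Fin n → Fin m → ℝ))))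

/-- The `1`-form `dp^λ_i`. -/
def dP (l : Fin n) (i : Fin m) : Coords n m →L[ℝ] ℝ :=
  (ContinuousLinearMap.proj (R := ℝ) (φ := fun _ : Fin m => ℝ) i).comp
    ((ContinuousLinearMap.proj (R := ℝ) (φ := fun _ : Fin n => Fin m → ℝ) l).comp
      ((ContinuousLinearMap.snd ℝ (Fin m → ℝ) (Fin n → Fin m → ℝ)).comp
        (ContinuousLinearMap.snd ℝ (Fin n → ℝ) ((Fin m → ℝ) × (Fin n → Fin m → ℝ)))))

/-- The `n`-form `ω = dx^1 ∧ ... ∧ dx^n`. -/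
def vol : Coords n m [⋀^Fin n]→L[ℝ] ℝ :=
  (stdVol n).compContinuousLinearMap
    (ContinuousLinearMap.fst ℝ (Fin n → ℝ) ((Fin m → ℝ) × (Fin n → Fin m → ℝ)))

/-- The `n`-form `dy^i ∧ ω_λ`, where `ω_λ = ∂_λ ⌋ ω`.  As `dy^i(∂_λ) = 0`, it is
`-∂_λ ⌋ (dy^i ∧ ω)`, a form of the expression that makes sense in every dimension `n`. -/
def dYVol (i : Fin m) (l : Fin n) : Coords n m [⋀^Fin n]→L[ℝ] ℝ :=
  -(wedge (dY i) (vol (n := n) (m := m))).curryLeft (eX l)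

/-- The value of the `n`-form `p^λ_i dy^i ∧ ω_λ` at the point with coordinates `w`. -/
def liouville (w : Coords n m) : Coords n m [⋀^Fin n]→L[ℝ] ℝ :=
  ∑ l : Fin n, ∑ i : Fin m, w.2.2 l i • dYVol i l

/-- The `(n+1)`-form
`γ ⌋ Ω = dp^λ_i ∧ dy^i ∧ ω_λ + γ^λ_{iλ} dy^i ∧ ω - γ^i_{(λ)} dp^λ_i ∧ ω`
for the element `γ = dx^λ ⊗ (∂_λ + γ^i_{(λ)} ∂_i + γ^μ_{iλ} ∂/∂p^μ_i)` of `J¹Π`, where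
`(g l).1 i` is `γ^i_{(l)}` and `(g l).2 k i` is `γ^k_{i l}`. -/
def contractOmega (g : Fin n → (Fin m → ℝ) × (Fin n → Fin m → ℝ)) :
    Coords n m [⋀^Fin (n + 1)]→L[ℝ] ℝ :=
  (∑ l : Fin n, ∑ i : Fin m, wedge (dP l i) (dYVol i l))
    + (∑ i : Fin m, (∑ l : Fin n, (g l).2 l i) • wedge (dY i) (vol (n := n) (m := m)))
    - ∑ l : Fin n, ∑ i : Fin m, (g l).1 i • wedge (dP l i) (vol (n := n) (m := m))

theorem vol_eX : vol (n := n) (m := m) eX = 1 := by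
  have : (fun l : Fin n => (eX (m := m) l).1) = (1 : Matrix (Fin n) (Fin n) ℝ) := by
    ext l k
    simp [eX, Matrix.one_apply, Pi.single_apply, eq_comm]
  change Matrix.det (fun l : Fin n => (eX (m := m) l).1) = 1
  rw [this, Matrix.det_one]

theorem vol_eq_zero (v : Fin n → Coords n m) (k : Fin n) (hk : (v k).1 = 0) :
    vol (n := n) (m := m) v = 0 := by
  change Matrix.det (fun l : Fin n => (v l).1) = 0
  exact Matrix.det_eq_zero_of_row_eq_zero k (fun j => by simp [hk])

theorem dYVol_eX (i : Fin m) (l : Fin n) : dYVol (n := n) (m := m) i l eX = 0 := by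
  have h : ∀ j : Fin (n + 1),
      dY i ((Fin.cons (eX l) eX : Fin (n + 1) → Coords n m) j) = 0 := by
    intro j
    refine Fin.cases ?_ (fun k => ?_) j <;> simp [dY, eX]
  change -(wedge (dY i) (vol (n := n) (m := m)) (Fin.cons (eX l) eX)) = 0
  rw [wedge_apply]
  simp only [h, zero_mul, mul_zero, Finset.sum_const_zero, neg_zero]

theorem liouville_apply (w : Coords n m) (v : Fin n → Coords n m) :
    liouville w v = ∑ l, ∑ i, w.2.2 l i * dYVol i l v := by
  simp [liouville, ContinuousAlternatingMap.sum_apply]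

/-- For `v = ∂/∂p^λ_i` or `v = ∂_i`, the coefficient `-d(p^λ_i dy^i ∧ ω_λ - ℋ ω)(v, ∂_1, ..., ∂_n)`
is the derivative of `ℋ` in the direction `v`. -/
theorem extDeriv_liouville_sub {h : Coords n m → ℝ} {w : Coords n m} (hh : DifferentiableAt ℝ h w)
    (v : Coords n m) (hv : v.1 = 0) :
    extDeriv (fun z => liouville z - h z • vol (n := n) (m := m)) w (Fin.cons v eX)
      = -fderiv ℝ h w v := by
  have hd : DifferentiableAt ℝ (fun z : Coords n m => liouville z - h z • vol) w := by
    unfold liouville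
    fun_prop
  rw [extDeriv_apply hd, Fin.sum_univ_succ]
  have h0 : (fun z : Coords n m => (liouville z - h z • vol (n := n) (m := m))
      (Fin.removeNth 0 (Fin.cons v eX : Fin (n + 1) → Coords n m))) = fun z => -h z := by
    ext z
    simp [Fin.removeNth_zero, liouville_apply, dYVol_eX, vol_eX]
  have hs : ∀ k : Fin n, fderiv ℝ (fun z : Coords n m => (liouville z - h z • vol (n := n) (m := m))
      (Fin.removeNth k.succ (Fin.cons v eX : Fin (n + 1) → Coords n m))) w (eX k) = 0 := by
    intro k
    set u := Fin.removeNth k.succ (Fin.cons v eX : Fin (n + 1) → Coords n m) with hu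
    have hvol : vol (n := n) (m := m) u = 0 := by
      refine vol_eq_zero u ⟨0, k.pos⟩ ?_
      have : u ⟨0, k.pos⟩ = v := by
        have e0 : k.succ.succAbove ⟨0, k.pos⟩ = 0 := by
          rw [Fin.succAbove_of_castSucc_lt]
          · rfl
          · exact Fin.mk_lt_mk.mpr (Nat.succ_pos _)
        rw [hu, Fin.removeNth, e0, Fin.cons_zero]
      rw [this, hv]
    have hf : (fun z : Coords n m => (liouville z - h z • vol (n := n) (m := m)) u)
        = fun z => ∑ l, ∑ i, z.2.2 l i * dYVol i l u := by
      ext z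
      simp [liouville_apply, hvol]
    rw [hf]
    have hdf : DifferentiableAt ℝ (fun z : Coords n m => ∑ l, ∑ i, z.2.2 l i * dYVol i l u) w := by
      fun_prop
    rw [← hdf.lineDeriv_eq_fderiv, lineDeriv]
    simp [eX]
  rw [h0]
  simp only [Fin.cons_succ, hs]
  simp

end CoordinateForms

/-! ### Fibred manifolds, fibred coordinates -/

/-- A fibred manifold: a surjective (smooth) submersion of an `(n+m)`-dimensional
manifold `Y` onto an `n`-dimensional manifold `X`. -/
structure FibredManifold (n m : ℕ) (X Y : Type*)
    [TopologicalSpace X] [ChartedSpace (EuclideanSpace ℝ (Fin n)) X]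
    [TopologicalSpace Y] [ChartedSpace (EuclideanSpace ℝ (Fin (n + m))) Y] where
  /-- the projection `π : Y → X` -/
  proj : Y → X
  surjective : Function.Surjective proj
  isSubmersion : Manifold.IsSubmersion (𝓡 (n + m)) (𝓡 n) ∞ proj

section

variable {n m : ℕ} {X Y : Type*}
  [TopologicalSpace X] [ChartedSpace (EuclideanSpace ℝ (Fin n)) X]
  [TopologicalSpace Y] [ChartedSpace (EuclideanSpace ℝ (Fin (n + m))) Y]

/-- Fibred coordinates `(x^λ, y^i)` on an open subset of `Y`, over coordinates `(x^λ)` on an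
open subset of `X`. -/
structure FibredChart (B : FibredManifold n m X Y) where
  /-- the coordinates `x^λ` on the base -/
  base : OpenPartialHomeomorph X (Fin n → ℝ)
  /-- the coordinates `(x^λ, y^i)` on the total space -/
  total : OpenPartialHomeomorph Y ((Fin n → ℝ) × (Fin m → ℝ))
  smooth_base : ContMDiffOn (𝓡 n) 𝓘(ℝ, Fin n → ℝ) ∞ base base.source
  smooth_base_symm : ContMDiffOn 𝓘(ℝ, Fin n → ℝ) (𝓡 n) ∞ base.symm base.target
  smooth_total : ContMDiffOn (𝓡 (n + m)) 𝓘(ℝ, (Fin n → ℝ) × (Fin m → ℝ)) ∞ total total.source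
  smooth_total_symm :
    ContMDiffOn 𝓘(ℝ, (Fin n → ℝ) × (Fin m → ℝ)) (𝓡 (n + m)) ∞ total.symm total.target
  proj_mem : ∀ y ∈ total.source, B.proj y ∈ base.source
  fst_total : ∀ y ∈ total.source, (total y).1 = base (B.proj y)

/-- The tangent map `T_yY → T_{π(y)}X` of the projection.  (In Mathlib the tangent spaces of `X` and
`Y` are by definition the model spaces `EuclideanSpace ℝ (Fin n)`,
`EuclideanSpace ℝ (Fin (n + m))`.) -/
def FibredManifold.tangentProj (B : FibredManifold n m X Y) (y : Y) :
    EuclideanSpace ℝ (Fin (n + m)) →L[ℝ] EuclideanSpace ℝ (Fin n) :=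
  mfderiv (𝓡 (n + m)) (𝓡 n) B.proj y

/-- The vertical tangent space `V_yY`. -/
def FibredManifold.vertical (B : FibredManifold n m X Y) (y : Y) :
    Submodule ℝ (EuclideanSpace ℝ (Fin (n + m))) :=
  LinearMap.ker (B.tangentProj y : EuclideanSpace ℝ (Fin (n + m)) →ₗ[ℝ] EuclideanSpace ℝ (Fin n))

/-- Every point of `Y` lies in the domain of fibred coordinates. -/
theorem exists_fibredChart [IsManifold (𝓡 n) ∞ X] [IsManifold (𝓡 (n + m)) ∞ Y]
    (B : FibredManifold n m X Y) (y : Y) : ∃ c : FibredChart B, y ∈ c.total.source := by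
  obtain ⟨F, _, _, hF⟩ := B.isSubmersion
  have h := hF y
  let e := h.equiv
  have : FiniteDimensional ℝ (EuclideanSpace ℝ (Fin n) × F) := e.toLinearEquiv.finiteDimensional
  have : FiniteDimensional ℝ F :=
    Module.Finite.of_surjective (LinearMap.snd ℝ (EuclideanSpace ℝ (Fin n)) F)
      LinearMap.snd_surjective
  have hdim : Module.finrank ℝ F = Module.finrank ℝ (Fin m → ℝ) := by
    have h1 := e.toLinearEquiv.finrank_eq
    rw [Module.finrank_prod] at h1
    simp at h1
    simp [← h1]
  let eF : F ≃L[ℝ] (Fin m → ℝ) := ContinuousLinearEquiv.ofFinrankEq hdim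
  let eX : EuclideanSpace ℝ (Fin n) ≃L[ℝ] (Fin n → ℝ) := EuclideanSpace.equiv (Fin n) ℝ
  let eT : EuclideanSpace ℝ (Fin (n + m)) ≃L[ℝ] ((Fin n → ℝ) × (Fin m → ℝ)) :=
    e.trans (eX.prodCongr eF)
  refine ⟨⟨h.codChart.trans eX.toHomeomorph.toOpenPartialHomeomorph,
    h.domChart.trans eT.toHomeomorph.toOpenPartialHomeomorph, ?_, ?_, ?_, ?_, ?_, ?_⟩, ?_⟩
  · have := contMDiffOn_of_mem_maximalAtlas h.codChart_mem_maximalAtlas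
    refine (eX.contDiff.contMDiff.comp_contMDiffOn this).mono ?_
    intro x hx; simpa using hx
  · have := contMDiffOn_symm_of_mem_maximalAtlas h.codChart_mem_maximalAtlas
    refine this.comp (eX.symm.contDiff.contMDiff.contMDiffOn) ?_
    intro x hx; simpa using hx
  · have := contMDiffOn_of_mem_maximalAtlas h.domChart_mem_maximalAtlas
    refine (eT.contDiff.contMDiff.comp_contMDiffOn this).mono ?_
    intro x hx; simpa using hx
  · have := contMDiffOn_symm_of_mem_maximalAtlas h.domChart_mem_maximalAtlas
    refine this.comp (eT.symm.contDiff.contMDiff.contMDiffOn) ?_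
    intro x hx; simpa using hx
  · intro z hz
    have hz' : z ∈ h.domChart.source := by simpa using hz
    simpa using h.source_subset_preimage_source hz'
  · intro z hz
    have hz' : z ∈ h.domChart.source := by simpa using hz
    have hm : h.domChart z ∈ (h.domChart.extend (𝓡 (n + m))).target := by
      simpa using h.domChart.map_source hz'
    have := h.writtenInCharts hm
    simp [h.domChart.left_inv hz'] at this
    simp [eT, e, this]
  · simpa using h.mem_domChart_source

namespace FibredChart

variable {B : FibredManifold n m X Y} (c : FibredChart B)

/-- The differential of the base coordinates at a point of `X`. -/
def dBase (x : X) : EuclideanSpace ℝ (Fin n) →L[ℝ] (Fin n → ℝ) :=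
  mfderiv (𝓡 n) 𝓘(ℝ, Fin n → ℝ) c.base x

/-- The inverse of `dBase`: the vector of `T_xX` with given components. -/
def dBaseSymm (x : X) : (Fin n → ℝ) →L[ℝ] EuclideanSpace ℝ (Fin n) :=
  mfderiv 𝓘(ℝ, Fin n → ℝ) (𝓡 n) c.base.symm (c.base x)

/-- The differential of the fibred coordinates at a point of `Y`. -/
def dTotal (y : Y) : EuclideanSpace ℝ (Fin (n + m)) →L[ℝ] (Fin n → ℝ) × (Fin m → ℝ) :=
  mfderiv (𝓡 (n + m)) 𝓘(ℝ, (Fin n → ℝ) × (Fin m → ℝ)) c.total y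

/-- The inverse of `dTotal`: the vector of `T_yY` with given components. -/
def dTotalSymm (y : Y) : (Fin n → ℝ) × (Fin m → ℝ) →L[ℝ] EuclideanSpace ℝ (Fin (n + m)) :=
  mfderiv 𝓘(ℝ, (Fin n → ℝ) × (Fin m → ℝ)) (𝓡 (n + m)) c.total.symm (c.total y)

/-- The coordinate vector `∂_λ ∈ T_xX`. -/
def frame (x : X) (l : Fin n) : EuclideanSpace ℝ (Fin n) := c.dBaseSymm x (Pi.single l 1)

/-- The coefficient of an element of `Λ^n T*_xX`, with respect to `ω = dx^1 ∧ ... ∧ dx^n`. -/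
def density (x : X) (d : EuclideanSpace ℝ (Fin n) [⋀^Fin n]→L[ℝ] ℝ) : ℝ := d (c.frame x)

/-- The element `ω = dx^1 ∧ ... ∧ dx^n` of `Λ^n T*_xX`. -/
def volAt (x : X) : EuclideanSpace ℝ (Fin n) [⋀^Fin n]→L[ℝ] ℝ :=
  (stdVol n).compContinuousLinearMap (c.dBase x)

/-- The points of the coordinate space that lie over the range of the fibred coordinates: the range
of the induced coordinates of `J¹Y` and of the Legendre manifold. -/
def target : Set (Coords n m) := {a | (a.1, a.2.1) ∈ c.total.target}

/-- The point of `Y` under a point of the coordinate space. -/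
def pt (a : Coords n m) : Y := c.total.symm (a.1, a.2.1)

theorem pt_mem {a : Coords n m} (ha : a ∈ c.target) : c.pt a ∈ c.total.source :=
  c.total.map_target ha

/-- The tangent map of the projection reads `(u, w) ↦ u` in fibred coordinates. -/
theorem tangentProj_dTotalSymm {y : Y} (hy : y ∈ c.total.source)
    (v : (Fin n → ℝ) × (Fin m → ℝ)) :
    B.tangentProj y (c.dTotalSymm y v) = c.dBaseSymm (B.proj y) v.1 := by
  have hty : c.total y ∈ c.total.target := c.total.map_source hy
  have hb : c.base (B.proj y) ∈ c.base.target := c.base.map_source (c.proj_mem y hy)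
  have h1 : HasMFDerivAt 𝓘(ℝ, (Fin n → ℝ) × (Fin m → ℝ)) (𝓡 (n + m)) c.total.symm (c.total y)
      (c.dTotalSymm y) :=
    ((c.smooth_total_symm.contMDiffAt (c.total.open_target.mem_nhds hty)).mdifferentiableAt
      (by simp)).hasMFDerivAt
  have hB : MDifferentiableAt (𝓡 (n + m)) (𝓡 n) B.proj y :=
    (B.isSubmersion.contMDiff y).mdifferentiableAt (by simp)
  have h2 : HasMFDerivAt (𝓡 (n + m)) (𝓡 n) B.proj (c.total.symm (c.total y))
      (B.tangentProj y) := by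
    rw [c.total.left_inv hy]; exact hB.hasMFDerivAt
  have h3 : HasMFDerivAt 𝓘(ℝ, Fin n → ℝ) (𝓡 n) c.base.symm
      ((ContinuousLinearMap.fst ℝ (Fin n → ℝ) (Fin m → ℝ)) (c.total y))
      (c.dBaseSymm (B.proj y)) := by
    have : (ContinuousLinearMap.fst ℝ (Fin n → ℝ) (Fin m → ℝ)) (c.total y)
        = c.base (B.proj y) := c.fst_total y hy
    rw [this]
    exact ((c.smooth_base_symm.contMDiffAt (c.base.open_target.mem_nhds hb)).mdifferentiableAt
      (by simp)).hasMFDerivAt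
  have h4 : HasMFDerivAt 𝓘(ℝ, (Fin n → ℝ) × (Fin m → ℝ)) 𝓘(ℝ, Fin n → ℝ)
      (ContinuousLinearMap.fst ℝ (Fin n → ℝ) (Fin m → ℝ)) (c.total y)
      (ContinuousLinearMap.fst ℝ (Fin n → ℝ) (Fin m → ℝ)) :=
    (ContinuousLinearMap.fst ℝ (Fin n → ℝ) (Fin m → ℝ)).hasMFDerivAt
  have h12 := h2.comp (c.total y) h1
  have h34 := h3.comp (c.total y) h4
  have heq : (B.proj ∘ c.total.symm) =ᶠ[nhds (c.total y)]
      (c.base.symm ∘ (ContinuousLinearMap.fst ℝ (Fin n → ℝ) (Fin m → ℝ))) := by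
    filter_upwards [c.total.open_target.mem_nhds hty] with z hz
    have hs := c.total.map_target hz
    have := c.fst_total _ hs
    rw [c.total.right_inv hz] at this
    simp [this, c.base.left_inv (c.proj_mem _ hs)]
  have := hasMFDerivAt_unique h12 (h34.congr_of_eventuallyEq heq)
  exact congrArg (fun f : (Fin n → ℝ) × (Fin m → ℝ) →L[ℝ] EuclideanSpace ℝ (Fin n) => f v) this

theorem dBaseSymm_dBase {x : X} (hx : x ∈ c.base.source) (u : EuclideanSpace ℝ (Fin n)) :
    c.dBaseSymm x (c.dBase x u) = u := by
  have hb : c.base x ∈ c.base.target := c.base.map_source hx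
  have h1 : HasMFDerivAt (𝓡 n) 𝓘(ℝ, Fin n → ℝ) c.base x (c.dBase x) :=
    ((c.smooth_base.contMDiffAt (c.base.open_source.mem_nhds hx)).mdifferentiableAt
      (by simp)).hasMFDerivAt
  have h2 : HasMFDerivAt 𝓘(ℝ, Fin n → ℝ) (𝓡 n) c.base.symm (c.base x) (c.dBaseSymm x) :=
    ((c.smooth_base_symm.contMDiffAt (c.base.open_target.mem_nhds hb)).mdifferentiableAt
      (by simp)).hasMFDerivAt
  have h3 : HasMFDerivAt (𝓡 n) (𝓡 n) id x
      (ContinuousLinearMap.id ℝ (TangentSpace (𝓡 n) x)) := hasMFDerivAt_id x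
  have heq : (c.base.symm ∘ c.base) =ᶠ[nhds x] id := by
    filter_upwards [c.base.open_source.mem_nhds hx] with z hz
    simp [c.base.left_inv hz]
  have := hasMFDerivAt_unique (h2.comp x h1) (h3.congr_of_eventuallyEq heq)
  exact congrArg (fun f : EuclideanSpace ℝ (Fin n) →L[ℝ] EuclideanSpace ℝ (Fin n) => f u) this

/-- The coordinate vector `∂_i ∈ V_yY`, for `y` in the domain of the fibred coordinates. -/
def verticalFrame (y : Y) (hy : y ∈ c.total.source) (i : Fin m) : B.vertical y :=
  ⟨c.dTotalSymm y (0, Pi.single i 1), by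
    have := c.tangentProj_dTotalSymm hy (0, Pi.single i 1)
    simpa [FibredManifold.vertical] using this⟩

end FibredChart

/-! ### The jet manifold `J¹Y` and the Legendre manifold `Π` -/

/-- The fibre over `y` of the jet bundle `J¹Y → Y`: the linear maps `T_{π(y)}X → T_yY` splitting the
tangent map of the projection, the jet at `x` of a section `s` being the tangent map `T_x s`. -/
def JetFibre (B : FibredManifold n m X Y) (y : Y) : Type :=
  {A : EuclideanSpace ℝ (Fin n) →L[ℝ] EuclideanSpace ℝ (Fin (n + m)) //
    (B.tangentProj y).comp A = ContinuousLinearMap.id ℝ (EuclideanSpace ℝ (Fin n))}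

/-- The jet manifold `J¹Y`, as a set of pairs of a point of `Y` and a jet at that point. -/
abbrev Jet (B : FibredManifold n m X Y) : Type _ := Σ y : Y, JetFibre B y

/-- The affine structure of `J¹Y → Y`, modelled on `T*X ⊗ VY = Hom(TX, VY)`. -/
def JetFibre.addVertical {B : FibredManifold n m X Y} {y : Y} (j : JetFibre B y)
    (σ : EuclideanSpace ℝ (Fin n) →L[ℝ] B.vertical y) : JetFibre B y :=
  ⟨j.1 + (B.vertical y).subtypeL.comp σ, by
    ext1 u
    have h1 := congrArg (fun f => f u) j.2
    have h2 : B.tangentProj y (σ u : EuclideanSpace ℝ (Fin (n + m))) = 0 := (σ u).2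
    simpa [h2] using h1⟩

/-- The fibre over `y` of the Legendre bundle `Π = Λ^n T*X ⊗ TX ⊗ V*Y → Y`, written as the space
`Hom(Hom(T_xX, V_yY), Λ^n T*_xX)`, where `x = π(y)`. -/
abbrev MomentumFibre (B : FibredManifold n m X Y) (y : Y) : Type :=
  (EuclideanSpace ℝ (Fin n) →L[ℝ] B.vertical y) →L[ℝ]
    (EuclideanSpace ℝ (Fin n) [⋀^Fin n]→L[ℝ] ℝ)

/-- The Legendre manifold `Π`, as a set of pairs of a point of `Y` and an element of the fibre. -/
abbrev Legendre (B : FibredManifold n m X Y) : Type _ := Σ y : Y, MomentumFibre B y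

namespace FibredChart

variable {B : FibredManifold n m X Y} (c : FibredChart B)

/-- The coordinates `y^i_λ` of a jet: the `y`-components of the image of `∂_λ`. -/
def jetComponents (j : Jet B) : Fin n → Fin m → ℝ :=
  fun l i => (c.dTotal j.1 (j.2.1 (c.frame (B.proj j.1) l))).2 i

/-- The adapted coordinates `(x^λ, y^i, y^i_λ)` of `J¹Y`. -/
def jetCoords (j : Jet B) : Coords n m :=
  ((c.total j.1).1, (c.total j.1).2, c.jetComponents j)

/-- The jet at `y` with coordinates `y^i_λ = v λ i`, that is, `dx^λ ⊗ (∂_λ + v^i_λ ∂_i)`. -/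
def jetAt (y : Y) (hy : y ∈ c.total.source) (v : Fin n → Fin m → ℝ) : JetFibre B y :=
  ⟨(c.dTotalSymm y).comp
      (((ContinuousLinearMap.id ℝ (Fin n → ℝ)).prod
        (∑ l : Fin n, (ContinuousLinearMap.proj (R := ℝ) (φ := fun _ : Fin n => ℝ) l).smulRight
          (v l))).comp (c.dBase (B.proj y))), by
    ext1 u
    have h := c.tangentProj_dTotalSymm hy
      (((ContinuousLinearMap.id ℝ (Fin n → ℝ)).prod
        (∑ l : Fin n, (ContinuousLinearMap.proj (R := ℝ) (φ := fun _ : Fin n => ℝ) l).smulRight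
          (v l))) (c.dBase (B.proj y) u))
    have h' := c.dBaseSymm_dBase (c.proj_mem y hy) u
    exact h.trans h'⟩

/-- The coordinates `p^λ_i` of a point of `Π` over the domain of the fibred coordinates:
`p(dx^λ ⊗ ∂_i) = p^λ_i ω`. -/
def momentumComponents (q : Legendre B) (hq : q.1 ∈ c.total.source) : Fin n → Fin m → ℝ :=
  fun l i => c.density (B.proj q.1)
    (q.2 (((ContinuousLinearMap.proj (R := ℝ) (φ := fun _ : Fin n => ℝ) l).comp
      (c.dBase (B.proj q.1))).smulRight (c.verticalFrame q.1 hq i)))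

open Classical in
/-- The fibred coordinates `(x^λ, y^i, p^λ_i)` of `Π`, on their domain `q.1 ∈ c.total.source`
(the value elsewhere is irrelevant). -/
def momentumCoords (q : Legendre B) : Coords n m :=
  if hq : q.1 ∈ c.total.source then
    ((c.total q.1).1, (c.total q.1).2, c.momentumComponents q hq)
  else 0

/-- The point of `Π` with given coordinates: over the point `(x^λ, y^i)` of `Y`, the linear map
`σ ↦ p^λ_i σ^i_λ ω`. -/
def ofMomentumCoords (w : Coords n m) : Legendre B :=
  ⟨c.pt w, ∑ l : Fin n, ∑ i : Fin m, w.2.2 l i •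
    (((ContinuousLinearMap.proj (R := ℝ) (φ := fun _ : Fin m => ℝ) i).comp
      ((ContinuousLinearMap.snd ℝ (Fin n → ℝ) (Fin m → ℝ)).comp
        ((c.dTotal (c.pt w)).comp (B.vertical (c.pt w)).subtypeL))).comp
      (ContinuousLinearMap.apply ℝ (B.vertical (c.pt w))
        (c.frame (B.proj (c.pt w)) l))).smulRight (c.volAt (B.proj (c.pt w)))⟩

/-- The transition map of `Π` from the coordinates given by `c` to those given by `c'`. -/
def transition (c' : FibredChart B) (w : Coords n m) : Coords n m :=
  c'.momentumCoords (c.ofMomentumCoords w)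

end FibredChart

/-! ### Lagrangian densities -/

open Classical in
/-- The function `ℒ(x^λ, y^i, y^i_λ)` with `L = ℒ ω`, on `c.target` (the value elsewhere is
irrelevant), for an assignment to each jet over `x` of an element of `Λ^n T*_xX`. -/
def densityCoordFun {B : FibredManifold n m X Y} (c : FibredChart B)
    (L : Jet B → EuclideanSpace ℝ (Fin n) [⋀^Fin n]→L[ℝ] ℝ) (a : Coords n m) : ℝ :=
  if ha : a ∈ c.target then
    c.density (B.proj (c.pt a)) (L ⟨c.pt a, c.jetAt (c.pt a) (c.pt_mem ha) a.2.2⟩)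
  else 0

/-- A first order Lagrangian density: a smooth horizontal density `L` on `J¹Y → X`.
Its value at a jet over `x` is an element of `Λ^n T*_xX`. -/
structure Lagrangian (B : FibredManifold n m X Y) where
  toFun : Jet B → EuclideanSpace ℝ (Fin n) [⋀^Fin n]→L[ℝ] ℝ
  smooth : ∀ c : FibredChart B, ContDiffOn ℝ ∞ (densityCoordFun c toFun) c.target

namespace Lagrangian

variable {B : FibredManifold n m X Y} (L : Lagrangian B)

/-- The function `ℒ(x^λ, y^i, y^i_λ)` with `L = ℒ ω`. -/
def coordFun (c : FibredChart B) : Coords n m → ℝ := densityCoordFun c L.toFun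

/-- The function `π^λ_i = ∂ℒ/∂y^i_λ`. -/
def momentum (c : FibredChart B) (l : Fin n) (i : Fin m) (a : Coords n m) : ℝ :=
  fderiv ℝ (L.coordFun c) a (eP l i)

/-- The Legendre morphism `L̂ : J¹Y → Π`: the derivative of `L` along the fibres of `J¹Y → Y`. -/
def legendre (j : Jet B) : Legendre B :=
  ⟨j.1, fderiv ℝ (fun σ : EuclideanSpace ℝ (Fin n) →L[ℝ] B.vertical j.1 =>
    L.toFun ⟨j.1, j.2.addVertical σ⟩) 0⟩

/-- The constraint space `Q = L̂(J¹Y)`. -/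
def constraintSpace : Set (Legendre B) := Set.range L.legendre

end Lagrangian

/-- A connected submanifold of a normed space: the image of an injective immersion of a connected
manifold.  (An embedded connected submanifold is one.) -/
def IsConnectedSubmanifold {V : Type} [NormedAddCommGroup V] [NormedSpace ℝ V] (S : Set V) : Prop :=
  ∃ (d : ℕ) (M : Type) (_ : TopologicalSpace M) (_ : ChartedSpace (EuclideanSpace ℝ (Fin d)) M),
    IsManifold (𝓡 d) ∞ M ∧ T2Space M ∧ SecondCountableTopology M ∧ ConnectedSpace M ∧
    ∃ f : M → V, Manifold.IsImmersion (𝓡 d) 𝓘(ℝ, V) ∞ f ∧ Function.Injective f ∧ Set.range f = S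

/-- A Lagrangian density is semiregular if the preimage under the Legendre morphism of every point
of the constraint space is a connected submanifold of `J¹Y`.  (The preimage of a point over `y`
lies in the domain of any adapted coordinates around `y`.) -/
def Lagrangian.Semiregular {B : FibredManifold n m X Y} (L : Lagrangian B) : Prop :=
  ∀ q ∈ L.constraintSpace, ∀ c : FibredChart B, q.1 ∈ c.total.source →
    IsConnectedSubmanifold (c.jetCoords '' {j | L.legendre j = q})

/-! ### Sections and the Euler-Lagrange equations -/

namespace FibredChart

variable {B : FibredManifold n m X Y} (c : FibredChart B)

/-- The coordinate points `x` for which the value at `x` of a section `s` over `U` lies in the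
domain of the fibred coordinates. -/
def sectionDomain (U : Set X) (s : X → Y) : Set (Fin n → ℝ) :=
  {u | u ∈ c.base.target ∧ c.base.symm u ∈ U ∧ s (c.base.symm u) ∈ c.total.source}

end FibredChart

section Sections

variable (B : FibredManifold n m X Y) (U : Set X)

/-- `s` is a smooth section of `Y → X` over `U`. -/
def IsSection (s : X → Y) : Prop :=
  (∀ x ∈ U, B.proj (s x) = x) ∧ ContMDiffOn (𝓡 n) (𝓡 (n + m)) ∞ s U

variable {B}

/-- `sbar` is a smooth section of `J¹Y → X` over `U`. -/
def IsJetSection (sbar : X → Jet B) : Prop :=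
  IsSection B U (fun x => (sbar x).1) ∧
    ∀ c : FibredChart B, ContDiffOn ℝ ∞ (fun u => c.jetCoords (sbar (c.base.symm u)))
      (c.sectionDomain U (fun x => (sbar x).1))

/-- `r` is a smooth section of `Π → X` over `U`. -/
def IsLegendreSection (r : X → Legendre B) : Prop :=
  IsSection B U (fun x => (r x).1) ∧
    ∀ c : FibredChart B, ContDiffOn ℝ ∞ (fun u => c.momentumCoords (r (c.base.symm u)))
      (c.sectionDomain U (fun x => (r x).1))

/-- `sbar` is the jet prolongation `J¹s` of `s` over `U`. -/
def IsJetProlongation (s : X → Y) (sbar : X → Jet B) : Prop :=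
  ∀ x ∈ U, (sbar x).1 = s x ∧ (sbar x).2.1 = mfderiv (𝓡 n) (𝓡 (n + m)) s x

/-- The first order Euler-Lagrange equations for `sbar` over `U`: in all fibred coordinates,
`∂_λ s̄^i = s̄^i_λ` and
`∂_i ℒ - (∂_λ + s̄^j_λ ∂_j + ∂_λ s̄^j_μ ∂/∂y^j_μ) ∂ℒ/∂y^i_λ = 0`. -/
def FirstOrderEulerLagrange (L : Lagrangian B) (sbar : X → Jet B) : Prop :=
  ∀ c : FibredChart B, ∀ u ∈ c.sectionDomain U (fun x => (sbar x).1),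
    let a : (Fin n → ℝ) → Coords n m := fun u => c.jetCoords (sbar (c.base.symm u))
    let D : Fin n → Coords n m := fun l => fderiv ℝ a u (Pi.single l 1)
    (∀ l i, (D l).2.1 i = (a u).2.2 l i) ∧
    ∀ i, fderiv ℝ (L.coordFun c) (a u) (eY i)
      - ∑ l, fderiv ℝ (L.momentum c l i) (a u) (Pi.single l 1, (a u).2.2 l, (D l).2.2) = 0

/-- The second order Euler-Lagrange equations `ℰ_L ∘ J²s = 0` for `s` over `U`: in all fibred
coordinates,
`∂_i ℒ - (∂_λ + ∂_λ s^j ∂_j + ∂_λ ∂_μ s^j ∂/∂y^j_μ) ∂ℒ/∂y^i_λ = 0`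
at the points `(x^λ, s^i, ∂_λ s^i)`. -/
def SecondOrderEulerLagrange (L : Lagrangian B) (s : X → Y) : Prop :=
  ∀ c : FibredChart B, ∀ u ∈ c.sectionDomain U s,
    let f : (Fin n → ℝ) → (Fin m → ℝ) := fun u => (c.total (s (c.base.symm u))).2
    let df : Fin n → (Fin n → ℝ) → (Fin m → ℝ) := fun k u => fderiv ℝ f u (Pi.single k 1)
    let a : Coords n m := (u, f u, fun k => df k u)
    ∀ i, fderiv ℝ (L.coordFun c) a (eY i)
      - ∑ l, fderiv ℝ (L.momentum c l i) a
          (Pi.single l 1, df l u, fun k => fderiv ℝ (df k) u (Pi.single l 1)) = 0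

end Sections

/-! ### Hamiltonian forms and the Hamilton equations -/

/-- An exterior `k`-form on the Legendre manifold `Π`, given by its expressions in all fibred
coordinates of `Π`. -/
structure LegendreForm (B : FibredManifold n m X Y) (k : ℕ) where
  toFun : FibredChart B → Coords n m → Coords n m [⋀^Fin k]→L[ℝ] ℝ
  smooth : ∀ c, ContDiffOn ℝ ∞ (toFun c) c.target
  pullback : ∀ c c', ∀ w ∈ c.target, c.pt w ∈ c'.total.source →
    toFun c w = (toFun c' (c.transition c' w)).compContinuousLinearMap
      (fderiv ℝ (c.transition c') w)

namespace LegendreForm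

variable {B : FibredManifold n m X Y} (H : LegendreForm B n)

/-- An `n`-form `H` on `Π` is a Hamiltonian form if near each point of `Π` there is a Hamiltonian
jet field `γ` (a smooth jet field with closed `γ ⌋ Ω`) with `γ ⌋ Ω = dH`. -/
def IsHamiltonian : Prop :=
  ∀ c : FibredChart B, ∀ w ∈ c.target, ∃ W : Set (Coords n m), IsOpen W ∧ w ∈ W ∧ W ⊆ c.target ∧
    ∃ g : Coords n m → Fin n → (Fin m → ℝ) × (Fin n → Fin m → ℝ), ContDiffOn ℝ ∞ g W ∧
      ∀ z ∈ W, extDeriv (fun z => contractOmega (g z)) z = 0 ∧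
        contractOmega (g z) = extDeriv (H.toFun c) z

/-- The derivative `∂ℋ/∂p^λ_i` of the Hamiltonian `ℋ` of a Hamiltonian form
`H = p^λ_i dy^i ∧ ω_λ - ℋ ω` (modulo closed forms).  As
`dH = dp^λ_i ∧ dy^i ∧ ω_λ - ∂_i ℋ dy^i ∧ ω - ∂ℋ/∂p^λ_i dp^λ_i ∧ ω`, it is determined by `dH`;
see `dHam_dP_eq`. -/
def dHam_dP (c : FibredChart B) (l : Fin n) (i : Fin m) (w : Coords n m) : ℝ :=
  -extDeriv (H.toFun c) w (Fin.cons (eP l i) eX)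

/-- The derivative `∂_i ℋ` of the Hamiltonian `ℋ` of a Hamiltonian form
`H = p^λ_i dy^i ∧ ω_λ - ℋ ω` (modulo closed forms); see `dHam_dY_eq`. -/
def dHam_dY (c : FibredChart B) (i : Fin m) (w : Coords n m) : ℝ :=
  -extDeriv (H.toFun c) w (Fin.cons (eY i) eX)

theorem dHam_dP_eq {c : FibredChart B} {w : Coords n m} {h : Coords n m → ℝ}
    (hh : DifferentiableAt ℝ h w)
    (hH : extDeriv (H.toFun c) w = extDeriv (fun z => liouville z - h z • vol) w)
    (l : Fin n) (i : Fin m) : H.dHam_dP c l i w = fderiv ℝ h w (eP l i) := by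
  rw [dHam_dP, hH, extDeriv_liouville_sub hh _ rfl, neg_neg]

theorem dHam_dY_eq {c : FibredChart B} {w : Coords n m} {h : Coords n m → ℝ}
    (hh : DifferentiableAt ℝ h w)
    (hH : extDeriv (H.toFun c) w = extDeriv (fun z => liouville z - h z • vol) w)
    (i : Fin m) : H.dHam_dY c i w = fderiv ℝ h w (eY i) := by
  rw [dHam_dY, hH, extDeriv_liouville_sub hh _ rfl, neg_neg]

/-- The momentum morphism `Ĥ : Π → J¹Y` of a Hamiltonian form, `y^i_λ ∘ Ĥ = ∂ℋ/∂p^λ_i`, written in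
some fibred coordinates around the given point (for a Hamiltonian form it does not depend on
them). -/
def momentumMorphism [IsManifold (𝓡 n) ∞ X] [IsManifold (𝓡 (n + m)) ∞ Y] (q : Legendre B) :
    Jet B :=
  ⟨q.1, (exists_fibredChart B q.1).choose.jetAt q.1 (exists_fibredChart B q.1).choose_spec
    (fun l i => H.dHam_dP (exists_fibredChart B q.1).choose l i
      ((exists_fibredChart B q.1).choose.momentumCoords q))⟩

/-- The expression `H_Ĥ + L ∘ Ĥ = p^λ_i dy^i ∧ ω_λ - (p^λ_i Ĥ^i_λ - ℒ ∘ Ĥ) ω` in fibred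
coordinates. -/
def associatedExpr [IsManifold (𝓡 n) ∞ X] [IsManifold (𝓡 (n + m)) ∞ Y] (L : Lagrangian B)
    (c : FibredChart B) (w : Coords n m) : Coords n m [⋀^Fin n]→L[ℝ] ℝ :=
  let j : Jet B := H.momentumMorphism (c.ofMomentumCoords w)
  liouville w - ((∑ l, ∑ i, w.2.2 l i * c.jetComponents j l i)
    - c.density (B.proj j.1) (L.toFun j)) • vol

/-- A Hamiltonian form `H` is associated with a Lagrangian density `L` if `L̂ ∘ Ĥ` is the identity
on `Q = L̂(J¹Y)`, and `H = H_Ĥ + L ∘ Ĥ` modulo closed forms. -/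
def IsAssociated [IsManifold (𝓡 n) ∞ X] [IsManifold (𝓡 (n + m)) ∞ Y] (L : Lagrangian B) : Prop :=
  (∀ q ∈ L.constraintSpace, L.legendre (H.momentumMorphism q) = q) ∧
  ∀ c : FibredChart B, ∀ w ∈ c.target,
    extDeriv (H.toFun c) w = extDeriv (H.associatedExpr L c) w

/-- The Hamilton equations for a section `r` of `Π → X` over `U`: in all fibred coordinates,
`∂_λ r^i = ∂ℋ/∂p^λ_i` and `∂_λ r^λ_i = -∂_i ℋ` along `r`. -/
def HamiltonEquations (U : Set X) (r : X → Legendre B) : Prop :=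
  ∀ c : FibredChart B, ∀ u ∈ c.sectionDomain U (fun x => (r x).1),
    let a : (Fin n → ℝ) → Coords n m := fun u => c.momentumCoords (r (c.base.symm u))
    let D : Fin n → Coords n m := fun l => fderiv ℝ a u (Pi.single l 1)
    (∀ l i, (D l).2.1 i = H.dHam_dP c l i (a u)) ∧
    ∀ i, ∑ l, (D l).2.2 l i = -H.dHam_dY c i (a u)

end LegendreForm

end

end Multimomentum

end

open Multimomentum

/-!
In fibred coordinates, a section `r` of `Π` with values in the constraint space and the section
`s̄ = Ĥ ∘ r` of `J¹Y` determine each other, since `r = L̂ ∘ s̄`: `s̄^i_λ = ∂ℋ/∂p^λ_i` along `r`, and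
`p^λ_i = ∂ℒ/∂y^i_λ` along `s̄`.  Conversely a jet section `s̄` with `Ĥ ∘ L̂ ∘ s̄ = s̄` corresponds in this
way to `r = L̂ ∘ s̄`.  The first relation turns the Hamilton equation `∂_λ r^i = ∂ℋ/∂p^λ_i` into
`∂_λ s̄^i = s̄^i_λ`; the second one turns `∂_λ r^λ_i` into the total derivative of `∂ℒ/∂y^i_λ` along `s̄`.
The remaining ingredient is `∂_i ℋ = -∂_i ℒ ∘ Ĥ` on the constraint space
(`LegendreForm.dHam_dY_of_mem_constraintSpace`): as `ℋ = p^λ_i Ĥ^i_λ - ℒ ∘ Ĥ`, its derivative through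
the arguments `Ĥ^i_λ` has the factor `p^λ_i - ∂ℒ/∂y^i_λ ∘ Ĥ`, which vanishes where `L̂ ∘ Ĥ` is the
identity.  So the two systems of equations are equivalent (`hamiltonEquations_iff`), and solutions
`s̄` are jet prolongations because of `∂_λ s̄^i = s̄^i_λ`.

This computation needs the momentum morphism to be given by `∂ℋ/∂p^λ_i` in all fibred coordinates at
once (`LegendreForm.jetAt_dHam_dP_eq`).  To see this, compare `dH` in two systems of coordinates on a
vector tangent to the fibres of `Π → Y` and on horizontal vectors that are flat in the first system and
lie over the coordinate vectors of the second one.  In the first system only `∂ℋ/∂p^λ_i` survives; in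
the second one the value is the pairing of a momentum with the difference of the flat jet and the
jet given by `∂ℋ'/∂p'^λ_i`.  The pairing of momenta with `T*X ⊗ VY` is independent of coordinates
(`FibredChart.momentum_pairing`), so the two jets agree.
-/

noncomputable section

namespace Multimomentum

/-! ### Evaluation of the coordinate forms -/

/-- Inserting `e` in front of `v` and omitting the entry number `k` of `v` amounts, up to the sign
of a cyclic permutation, to replacing that entry by `e`. -/
theorem neg_one_pow_mul_removeNth_succ_cons {V : Type*}
    [NormedAddCommGroup V] [NormedSpace ℝ V] {n : ℕ} (β : V [⋀^Fin n]→L[ℝ] ℝ) (e : V)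
    (v : Fin n → V) (k : Fin n) :
    (-1) ^ (k.succ : ℕ) * β (k.succ.removeNth (Fin.cons e v : Fin (n + 1) → V))
      = -β (Function.update v k e) := by
  obtain _ | n := n
  · exact k.elim0
  have h1 : k.succ.removeNth (Fin.cons e v : Fin (n + 2) → V)
      = Matrix.vecCons e (k.removeNth v) := by
    ext j
    refine Fin.cases ?_ (fun j => ?_) j
    · simp [Fin.removeNth]
    · simp [Fin.removeNth]
  have h2 : Function.update v k e = k.insertNth e (k.removeNth v) := by
    simp
  have h3 := β.toAlternatingMap.map_insertNth k e (k.removeNth v)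
  rw [h1, h2]
  have h4 : β (k.insertNth e (k.removeNth v)) = (-1) ^ (k : ℕ) •
    β (Matrix.vecCons e (k.removeNth v)) := h3
  rw [h4, Fin.val_succ, pow_succ]
  simp

section CoordinateForms

variable {n m : ℕ}

theorem vol_apply (v : Fin n → Coords n m) :
    vol (n := n) (m := m) v = stdVol n (fun k => (v k).1) := rfl

theorem stdVol_apply (v : Fin n → Fin n → ℝ) : stdVol n v = Matrix.det v := rfl

/-- The form `dy^i ∧ ω_λ` as a sum over the slot that `dy^i` is evaluated on, that slot of `ω` being
filled with `∂_λ`. -/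
theorem dYVol_apply (i : Fin m) (l : Fin n) (v : Fin n → Coords n m) :
    dYVol i l v = ∑ k, (v k).2.1 i * vol (n := n) (m := m) (Function.update v k (eX l)) := by
  change -(wedge (dY i) (vol (n := n) (m := m)) (Fin.cons (eX l) v)) = _
  have h0 : dY i (eX (m := m) l) = 0 := by simp [dY, eX]
  rw [wedge_apply, Fin.sum_univ_succ]
  simp only [mul_left_comm _ (dY i _), Fin.cons_zero, h0, zero_mul, mul_zero, zero_add,
    neg_one_pow_mul_removeNth_succ_cons, Fin.cons_succ, mul_neg,
    Finset.sum_neg_distrib, neg_neg]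
  rfl

/-- On vectors with base components `∂_1, ..., ∂_n`, the form `dy^i ∧ ω_λ` is the component `y^i` of
the vector number `λ`. -/
theorem dYVol_of_fst_eq (i : Fin m) (l : Fin n) (v : Fin n → Coords n m)
    (hv : ∀ k, (v k).1 = Pi.single k 1) : dYVol i l v = (v l).2.1 i := by
  rw [dYVol_apply, Finset.sum_eq_single l]
  · have : Matrix.det (fun k => (Function.update v l (eX l) k).1) = 1 := by
      have : (fun k => (Function.update v l (eX l) k).1) = (1 : Matrix (Fin n) (Fin n) ℝ) := by
        ext k j
        by_cases h : k = l
        · subst h; simp [eX, Matrix.one_apply, Pi.single_apply, eq_comm]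
        · simp [h, hv, Matrix.one_apply, Pi.single_apply, eq_comm]
      rw [this, Matrix.det_one]
    rw [vol_apply, stdVol_apply, this, mul_one]
  · intro k _ hk
    have : Matrix.det (fun j => (Function.update v k (eX l) j).1) = 0 := by
      refine Matrix.det_zero_of_row_eq hk ?_
      simp [Function.update_of_ne hk.symm, hv, eX]
    rw [vol_apply, stdVol_apply, this, mul_zero]
  · simp

/-- A form `γ ⌋ Ω`, evaluated on a vector tangent to the fibres of `Π → Y` and `n` more vectors. -/
theorem contractOmega_cons_vertical (g : Fin n → (Fin m → ℝ) × (Fin n → Fin m → ℝ))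
    (P : Fin n → Fin m → ℝ) (v : Fin n → Coords n m) :
    contractOmega g (Fin.cons (0, 0, P) v)
      = ∑ l, ∑ i, P l i * (dYVol i l v - (g l).1 i * vol (n := n) (m := m) v) := by
  have hvol : ∀ k : Fin n, vol (n := n) (m := m)
      (Function.update v k ((0, 0, P) : Coords n m)) = 0 :=
    fun k => vol_eq_zero _ k (by simp)
  have hdY : ∀ (i : Fin m) (l k : Fin n),
      dYVol i l (Function.update v k ((0, 0, P) : Coords n m)) = 0 := by
    intro i l k
    rw [dYVol_apply]
    refine Finset.sum_eq_zero fun j _ => ?_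
    by_cases h : j = k
    · subst h; simp
    · rw [vol_eq_zero _ k (by rw [Function.update_of_ne (Ne.symm h)]; simp), mul_zero]
  have key : ∀ (α : Coords n m →L[ℝ] ℝ) (β : Coords n m [⋀^Fin n]→L[ℝ] ℝ),
      (∀ k, β (Function.update v k ((0, 0, P) : Coords n m)) = 0) →
      wedge α β (Fin.cons ((0, 0, P) : Coords n m) v) = α (0, 0, P) * β v := by
    intro α β hβ
    rw [wedge_apply, Fin.sum_univ_succ]
    have : ∀ k : Fin n, (-1) ^ (k.succ : ℕ) * (α ((Fin.cons ((0, 0, P) : Coords n m) v :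
        Fin (n + 1) → Coords n m) k.succ) * β (k.succ.removeNth (Fin.cons ((0, 0, P) : Coords n m) v :
          Fin (n + 1) → Coords n m))) = 0 := by
      intro k
      rw [mul_left_comm, neg_one_pow_mul_removeNth_succ_cons, hβ]
      simp
    simp only [this, Finset.sum_const_zero, add_zero]
    simp [Fin.removeNth_zero]
  simp only [contractOmega, ContinuousAlternatingMap.sub_apply, ContinuousAlternatingMap.add_apply,
    ContinuousAlternatingMap.sum_apply, ContinuousAlternatingMap.smul_apply, smul_eq_mul,
    key _ _ hvol, key _ _ (hdY _ _)]
  simp [dY, dP, mul_sub, Finset.sum_sub_distrib, mul_left_comm]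

end CoordinateForms


variable {n m : ℕ} {X Y : Type*}
  [TopologicalSpace X] [ChartedSpace (EuclideanSpace ℝ (Fin n)) X]
  [TopologicalSpace Y] [ChartedSpace (EuclideanSpace ℝ (Fin (n + m))) Y]
  {B : FibredManifold n m X Y}

namespace FibredChart

variable (c : FibredChart B)

/-! ### Tangent maps of fibred coordinates -/

theorem hasMFDerivAt_base {x : X} (hx : x ∈ c.base.source) :
    HasMFDerivAt (𝓡 n) 𝓘(ℝ, Fin n → ℝ) c.base x (c.dBase x) :=
  ((c.smooth_base.contMDiffAt (c.base.open_source.mem_nhds hx)).mdifferentiableAt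
    (by simp)).hasMFDerivAt

theorem hasMFDerivAt_base_symm {x : X} (hx : x ∈ c.base.source) :
    HasMFDerivAt 𝓘(ℝ, Fin n → ℝ) (𝓡 n) c.base.symm (c.base x) (c.dBaseSymm x) :=
  ((c.smooth_base_symm.contMDiffAt (c.base.open_target.mem_nhds
    (c.base.map_source hx))).mdifferentiableAt (by simp)).hasMFDerivAt

theorem hasMFDerivAt_total {y : Y} (hy : y ∈ c.total.source) :
    HasMFDerivAt (𝓡 (n + m)) 𝓘(ℝ, (Fin n → ℝ) × (Fin m → ℝ)) c.total y (c.dTotal y) :=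
  ((c.smooth_total.contMDiffAt (c.total.open_source.mem_nhds hy)).mdifferentiableAt
    (by simp)).hasMFDerivAt

theorem hasMFDerivAt_total_symm {y : Y} (hy : y ∈ c.total.source) :
    HasMFDerivAt 𝓘(ℝ, (Fin n → ℝ) × (Fin m → ℝ)) (𝓡 (n + m)) c.total.symm (c.total y)
      (c.dTotalSymm y) :=
  ((c.smooth_total_symm.contMDiffAt (c.total.open_target.mem_nhds
    (c.total.map_source hy))).mdifferentiableAt (by simp)).hasMFDerivAt

theorem dBase_dBaseSymm {x : X} (hx : x ∈ c.base.source) (u : Fin n → ℝ) :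
    c.dBase x (c.dBaseSymm x u) = u := by
  have h1 : HasMFDerivAt (𝓡 n) 𝓘(ℝ, Fin n → ℝ) c.base (c.base.symm (c.base x)) (c.dBase x) := by
    rw [c.base.left_inv hx]; exact c.hasMFDerivAt_base hx
  have h3 : HasMFDerivAt 𝓘(ℝ, Fin n → ℝ) 𝓘(ℝ, Fin n → ℝ) id (c.base x)
      (ContinuousLinearMap.id ℝ (TangentSpace 𝓘(ℝ, Fin n → ℝ) (c.base x))) := hasMFDerivAt_id _
  have heq : (c.base ∘ c.base.symm) =ᶠ[nhds (c.base x)] id := by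
    filter_upwards [c.base.open_target.mem_nhds (c.base.map_source hx)] with z hz
    simp [c.base.right_inv hz]
  have := hasMFDerivAt_unique (h1.comp _ (c.hasMFDerivAt_base_symm hx))
    (h3.congr_of_eventuallyEq heq)
  exact congrArg (fun f : (Fin n → ℝ) →L[ℝ] (Fin n → ℝ) => f u) this

theorem dTotal_dTotalSymm {y : Y} (hy : y ∈ c.total.source) (u : (Fin n → ℝ) × (Fin m → ℝ)) :
    c.dTotal y (c.dTotalSymm y u) = u := by
  have h1 : HasMFDerivAt (𝓡 (n + m)) 𝓘(ℝ, (Fin n → ℝ) × (Fin m → ℝ)) c.total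
      (c.total.symm (c.total y)) (c.dTotal y) := by
    rw [c.total.left_inv hy]; exact c.hasMFDerivAt_total hy
  have h3 : HasMFDerivAt 𝓘(ℝ, (Fin n → ℝ) × (Fin m → ℝ)) 𝓘(ℝ, (Fin n → ℝ) × (Fin m → ℝ)) id
      (c.total y) (ContinuousLinearMap.id ℝ
        (TangentSpace 𝓘(ℝ, (Fin n → ℝ) × (Fin m → ℝ)) (c.total y))) := hasMFDerivAt_id _
  have heq : (c.total ∘ c.total.symm) =ᶠ[nhds (c.total y)] id := by
    filter_upwards [c.total.open_target.mem_nhds (c.total.map_source hy)] with z hz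
    simp [c.total.right_inv hz]
  have := hasMFDerivAt_unique (h1.comp _ (c.hasMFDerivAt_total_symm hy))
    (h3.congr_of_eventuallyEq heq)
  exact congrArg (fun f : (Fin n → ℝ) × (Fin m → ℝ) →L[ℝ] (Fin n → ℝ) × (Fin m → ℝ) => f u) this

theorem dTotalSymm_dTotal {y : Y} (hy : y ∈ c.total.source) (u : EuclideanSpace ℝ (Fin (n + m))) :
    c.dTotalSymm y (c.dTotal y u) = u := by
  have h3 : HasMFDerivAt (𝓡 (n + m)) (𝓡 (n + m)) id y
      (ContinuousLinearMap.id ℝ (TangentSpace (𝓡 (n + m)) y)) := hasMFDerivAt_id y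
  have heq : (c.total.symm ∘ c.total) =ᶠ[nhds y] id := by
    filter_upwards [c.total.open_source.mem_nhds hy] with z hz
    simp [c.total.left_inv hz]
  have := hasMFDerivAt_unique ((c.hasMFDerivAt_total_symm hy).comp y (c.hasMFDerivAt_total hy))
    (h3.congr_of_eventuallyEq heq)
  exact congrArg (fun f : EuclideanSpace ℝ (Fin (n + m)) →L[ℝ] EuclideanSpace ℝ (Fin (n + m)) =>
    f u) this

theorem fst_dTotal {y : Y} (hy : y ∈ c.total.source) (v : EuclideanSpace ℝ (Fin (n + m))) :
    (c.dTotal y v).1 = c.dBase (B.proj y) (B.tangentProj y v) := by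
  rw [← c.dTotalSymm_dTotal hy v, c.tangentProj_dTotalSymm hy, c.dTotal_dTotalSymm hy,
    c.dBase_dBaseSymm (c.proj_mem y hy)]

theorem dTotal_injective {y : Y} (hy : y ∈ c.total.source) : Function.Injective (c.dTotal y) :=
  Function.LeftInverse.injective (c.dTotalSymm_dTotal hy)

theorem dBase_frame {x : X} (hx : x ∈ c.base.source) (l : Fin n) :
    c.dBase x (c.frame x l) = Pi.single l 1 :=
  c.dBase_dBaseSymm hx _

/-- A tangent vector of `X` in terms of the coordinate vectors. -/
theorem sum_dBase_smul_frame {x : X} (hx : x ∈ c.base.source) (u : EuclideanSpace ℝ (Fin n)) :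
    ∑ l, c.dBase x u l • c.frame x l = u := by
  conv_rhs => rw [← c.dBaseSymm_dBase hx u, pi_eq_sum_univ' (c.dBase x u)]
  simp [frame, map_sum, Pi.single]

/-- Linear maps on a tangent space of `X` that agree on the coordinate vectors are equal. -/
theorem clm_ext_frame {F : Type*} [NormedAddCommGroup F] [NormedSpace ℝ F] {x : X}
    (hx : x ∈ c.base.source) {f g : EuclideanSpace ℝ (Fin n) →L[ℝ] F}
    (h : ∀ l, f (c.frame x l) = g (c.frame x l)) : f = g := by
  ext1 u
  rw [← c.sum_dBase_smul_frame hx u]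
  simp [map_sum, h]

/-! ### Components of densities -/

theorem density_volAt {x : X} (hx : x ∈ c.base.source) : c.density x (c.volAt x) = 1 := by
  change Matrix.det (fun l => c.dBase x (c.frame x l)) = 1
  have : (fun l => c.dBase x (c.frame x l)) = (1 : Matrix (Fin n) (Fin n) ℝ) := by
    ext l k
    simp [c.dBase_frame hx, Matrix.one_apply, Pi.single_apply, eq_comm]
  rw [this, Matrix.det_one]

theorem eq_density_smul_volAt {x : X} (hx : x ∈ c.base.source)
    (d : EuclideanSpace ℝ (Fin n) [⋀^Fin n]→L[ℝ] ℝ) : d = c.density x d • c.volAt x := by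
  have h := AlternatingMap.eq_smul_basis_det (Pi.basisFun ℝ (Fin n))
    (d.toAlternatingMap.compLinearMap (c.dBaseSymm x : (Fin n → ℝ) →ₗ[ℝ] EuclideanSpace ℝ (Fin n)))
  ext v
  have h2 := congrArg (fun f => f fun k => c.dBase x (v k)) h
  simp only [AlternatingMap.compLinearMap_apply, AlternatingMap.smul_apply, smul_eq_mul,
    Pi.basisFun_det_apply, Pi.basisFun_apply] at h2
  change d (fun k => c.dBaseSymm x (c.dBase x (v k))) = d (c.frame x) *
    Matrix.det (fun k => c.dBase x (v k)) at h2
  simp only [c.dBaseSymm_dBase hx] at h2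
  exact h2

theorem density_injective {x : X} (hx : x ∈ c.base.source) : Function.Injective (c.density x) := by
  intro d d' h
  rw [c.eq_density_smul_volAt hx d, c.eq_density_smul_volAt hx d', h]

/-- `density` as a continuous linear map. -/
def densityCLM (x : X) : (EuclideanSpace ℝ (Fin n) [⋀^Fin n]→L[ℝ] ℝ) →L[ℝ] ℝ :=
  ContinuousAlternatingMap.apply ℝ (EuclideanSpace ℝ (Fin n)) ℝ (c.frame x)

theorem densityCLM_apply (x : X) (d : EuclideanSpace ℝ (Fin n) [⋀^Fin n]→L[ℝ] ℝ) :
    c.densityCLM x d = c.density x d := rfl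

/-! ### Components of vertical-valued maps and of jets -/

/-- The components `σ^i_λ` of an element `σ = σ^i_λ dx^λ ⊗ ∂_i` of `T*X ⊗ VY = Hom(TX, VY)`. -/
def homComponents (y : Y) : (EuclideanSpace ℝ (Fin n) →L[ℝ] B.vertical y) →L[ℝ]
    (Fin n → Fin m → ℝ) :=
  ContinuousLinearMap.pi fun l => (ContinuousLinearMap.snd ℝ (Fin n → ℝ) (Fin m → ℝ)).comp
    ((c.dTotal y).comp ((B.vertical y).subtypeL.comp
      (ContinuousLinearMap.apply ℝ (B.vertical y) (c.frame (B.proj y) l))))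

theorem homComponents_apply (y : Y) (σ : EuclideanSpace ℝ (Fin n) →L[ℝ] B.vertical y)
    (l : Fin n) : c.homComponents y σ l
      = (c.dTotal y (σ (c.frame (B.proj y) l) : EuclideanSpace ℝ (Fin (n + m)))).2 := rfl

/-- The element `dx^λ ⊗ ∂_i` of `T*X ⊗ VY`. -/
def homBasis (y : Y) (hy : y ∈ c.total.source) (l : Fin n) (i : Fin m) :
    EuclideanSpace ℝ (Fin n) →L[ℝ] B.vertical y :=
  ((ContinuousLinearMap.proj (R := ℝ) (φ := fun _ : Fin n => ℝ) l).comp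
      (c.dBase (B.proj y))).smulRight (c.verticalFrame y hy i)

theorem fst_dTotal_vertical {y : Y} (hy : y ∈ c.total.source) (v : B.vertical y) :
    (c.dTotal y (v : EuclideanSpace ℝ (Fin (n + m)))).1 = 0 := by
  rw [c.fst_dTotal hy]
  have : B.tangentProj y (v : EuclideanSpace ℝ (Fin (n + m))) = 0 := v.2
  rw [this, map_zero]

theorem homComponents_injective {y : Y} (hy : y ∈ c.total.source) :
    Function.Injective (c.homComponents y) := by
  intro σ τ h
  refine c.clm_ext_frame (c.proj_mem y hy) fun l => Subtype.ext (c.dTotal_injective hy ?_)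
  refine Prod.ext ?_ (congrFun h l)
  rw [c.fst_dTotal_vertical hy, c.fst_dTotal_vertical hy]

theorem homComponents_homBasis {y : Y} (hy : y ∈ c.total.source) (l : Fin n) (i : Fin m) :
    c.homComponents y (c.homBasis y hy l i) = Pi.single l (Pi.single i 1) := by
  ext k j
  rw [homComponents_apply]
  simp [homBasis, c.dBase_frame (c.proj_mem y hy), verticalFrame, c.dTotal_dTotalSymm hy]
  by_cases h : k = l
  · subst h; simp
  · simp [h, Pi.single_apply, Ne.symm h]

theorem eq_sum_homBasis {y : Y} (hy : y ∈ c.total.source)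
    (σ : EuclideanSpace ℝ (Fin n) →L[ℝ] B.vertical y) :
    σ = ∑ l, ∑ i, c.homComponents y σ l i • c.homBasis y hy l i := by
  apply c.homComponents_injective hy
  simp only [map_sum, map_smul, c.homComponents_homBasis hy]
  ext k j
  rw [Finset.sum_apply, Finset.sum_apply, Finset.sum_eq_single k]
  · simp [Finset.sum_apply, Pi.single_apply]
  · intro l _ hl
    simp [Finset.sum_apply, hl.symm]
  · simp

theorem jetComponents_addVertical (y : Y) (j : JetFibre B y)
    (σ : EuclideanSpace ℝ (Fin n) →L[ℝ] B.vertical y) :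
    c.jetComponents ⟨y, j.addVertical σ⟩ = c.jetComponents ⟨y, j⟩ + c.homComponents y σ := by
  ext l i
  simp [jetComponents, JetFibre.addVertical, homComponents_apply]

theorem dTotal_jet_frame {y : Y} (hy : y ∈ c.total.source) (j : JetFibre B y) (l : Fin n) :
    c.dTotal y (j.1 (c.frame (B.proj y) l)) = (Pi.single l 1, c.jetComponents ⟨y, j⟩ l) := by
  refine Prod.ext ?_ rfl
  have h : B.tangentProj y (j.1 (c.frame (B.proj y) l)) = c.frame (B.proj y) l :=
    congrArg (fun f => f (c.frame (B.proj y) l)) j.2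
  rw [c.fst_dTotal hy, h, c.dBase_frame (c.proj_mem y hy)]

theorem jet_ext {y : Y} (hy : y ∈ c.total.source) {j j' : JetFibre B y}
    (h : c.jetComponents ⟨y, j⟩ = c.jetComponents ⟨y, j'⟩) : j = j' := by
  refine Subtype.ext (c.clm_ext_frame (c.proj_mem y hy) fun l => c.dTotal_injective hy ?_)
  rw [c.dTotal_jet_frame hy, c.dTotal_jet_frame hy, h]

theorem dTotal_jetAt {y : Y} (hy : y ∈ c.total.source) (v : Fin n → Fin m → ℝ)
    (u : EuclideanSpace ℝ (Fin n)) : c.dTotal y ((c.jetAt y hy v).1 u)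
      = (c.dBase (B.proj y) u, ∑ l, c.dBase (B.proj y) u l • v l) := by
  simp [jetAt, c.dTotal_dTotalSymm hy]

theorem jetComponents_jetAt {y : Y} (hy : y ∈ c.total.source) (v : Fin n → Fin m → ℝ) :
    c.jetComponents ⟨y, c.jetAt y hy v⟩ = v := by
  ext l i
  have := c.dTotal_jetAt hy v (c.frame (B.proj y) l)
  rw [jetComponents]
  dsimp only
  rw [this, c.dBase_frame (c.proj_mem y hy)]
  simp only [Pi.single_apply, ite_smul, one_smul, zero_smul, Finset.sum_ite_eq', Finset.mem_univ,
    if_true]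

theorem jetAt_jetComponents {y : Y} (hy : y ∈ c.total.source) (j : JetFibre B y) :
    c.jetAt y hy (c.jetComponents ⟨y, j⟩) = j :=
  c.jet_ext hy (c.jetComponents_jetAt hy _)

end FibredChart

/-- The difference of two jets at a point of `Y`, an element of `T*X ⊗ VY`. -/
def JetFibre.diff {y : Y} (j j' : JetFibre B y) :
    EuclideanSpace ℝ (Fin n) →L[ℝ] B.vertical y :=
  (j.1 - j'.1).codRestrict (B.vertical y) (fun u => by
    have h1 := congrArg (fun f => f u) j.2
    have h2 := congrArg (fun f => f u) j'.2
    simp only [ContinuousLinearMap.comp_apply] at h1 h2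
    simp [FibredManifold.vertical, h1, h2])

theorem FibredChart.homComponents_diff (c : FibredChart B) {y : Y}
    (j j' : JetFibre B y) : c.homComponents y (j.diff j')
      = c.jetComponents ⟨y, j⟩ - c.jetComponents ⟨y, j'⟩ := by
  ext l i
  have : ((j.diff j') (c.frame (B.proj y) l) : EuclideanSpace ℝ (Fin (n + m)))
      = j.1 (c.frame (B.proj y) l) - j'.1 (c.frame (B.proj y) l) := rfl
  rw [homComponents_apply, this, map_sub]
  rfl



namespace FibredChart

variable (c : FibredChart B)

/-! ### Coordinates of the Legendre manifold -/

theorem momentumCoords_of_mem {q : Legendre B} (hq : q.1 ∈ c.total.source) :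
    c.momentumCoords q = ((c.total q.1).1, (c.total q.1).2, c.momentumComponents q hq) := by
  rw [momentumCoords, dif_pos hq]

theorem momentumComponents_eq {q : Legendre B} (hq : q.1 ∈ c.total.source) (l : Fin n)
    (i : Fin m) : c.momentumComponents q hq l i
      = c.density (B.proj q.1) (q.2 (c.homBasis q.1 hq l i)) := rfl

/-- A momentum paired with `σ ∈ T*X ⊗ VY` is `p^λ_i σ^i_λ ω`. -/
theorem momentum_pairing {q : Legendre B} (hq : q.1 ∈ c.total.source)
    (σ : EuclideanSpace ℝ (Fin n) →L[ℝ] B.vertical q.1) :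
    q.2 σ = (∑ l, ∑ i, c.momentumComponents q hq l i * c.homComponents q.1 σ l i) •
      c.volAt (B.proj q.1) := by
  have hx := c.proj_mem _ hq
  apply c.density_injective hx
  conv_lhs => rw [c.eq_sum_homBasis hq σ]
  simp only [← c.densityCLM_apply, map_sum, map_smul, smul_eq_mul, c.momentumComponents_eq]
  rw [c.densityCLM_apply _ (c.volAt _), c.density_volAt hx, mul_one]
  simp only [mul_comm]

theorem momentumFibre_ext {y : Y} (hy : y ∈ c.total.source) {p p' : MomentumFibre B y}
    (h : c.momentumComponents ⟨y, p⟩ hy = c.momentumComponents ⟨y, p'⟩ hy) : p = p' := by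
  ext1 σ
  have h1 := c.momentum_pairing (q := ⟨y, p⟩) hy σ
  have h2 := c.momentum_pairing (q := ⟨y, p'⟩) hy σ
  rw [h] at h1
  exact h1.trans h2.symm

theorem ofMomentumCoords_snd_apply (w : Coords n m)
    (σ : EuclideanSpace ℝ (Fin n) →L[ℝ] B.vertical (c.pt w)) :
    (c.ofMomentumCoords w).2 σ
      = (∑ l, ∑ i, w.2.2 l i * c.homComponents (c.pt w) σ l i) • c.volAt (B.proj (c.pt w)) := by
  change (∑ l : Fin n, ∑ i : Fin m, w.2.2 l i •
    (((ContinuousLinearMap.proj (R := ℝ) (φ := fun _ : Fin m => ℝ) i).comp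
      ((ContinuousLinearMap.snd ℝ (Fin n → ℝ) (Fin m → ℝ)).comp
        ((c.dTotal (c.pt w)).comp (B.vertical (c.pt w)).subtypeL))).comp
      (ContinuousLinearMap.apply ℝ (B.vertical (c.pt w))
        (c.frame (B.proj (c.pt w)) l))).smulRight (c.volAt (B.proj (c.pt w))) :
          MomentumFibre B (c.pt w)) σ = _
  simp [homComponents_apply, Finset.sum_smul, mul_smul]

theorem ofMomentumCoords_mem {w : Coords n m} (hw : w ∈ c.target) :
    (c.ofMomentumCoords w).1 ∈ c.total.source := c.pt_mem hw

theorem total_pt {w : Coords n m} (hw : w ∈ c.target) : c.total (c.pt w) = (w.1, w.2.1) :=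
  c.total.right_inv hw

theorem base_proj_pt {w : Coords n m} (hw : w ∈ c.target) : c.base (B.proj (c.pt w)) = w.1 := by
  rw [← c.fst_total _ (c.pt_mem hw), c.total_pt hw]

theorem momentumComponents_ofMomentumCoords {w : Coords n m} (hw : w ∈ c.target) :
    c.momentumComponents (c.ofMomentumCoords w) (c.ofMomentumCoords_mem hw) = w.2.2 := by
  have hx := c.proj_mem _ (c.pt_mem hw)
  ext l i
  rw [c.momentumComponents_eq]
  have h := c.ofMomentumCoords_snd_apply w (c.homBasis (c.pt w) (c.pt_mem hw) l i)
  refine (congrArg (c.density (B.proj (c.pt w))) h).trans ?_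
  rw [← c.densityCLM_apply, map_smul, c.densityCLM_apply, c.density_volAt hx,
    c.homComponents_homBasis (c.pt_mem hw), smul_eq_mul, mul_one, Finset.sum_eq_single l]
  · simp [Pi.single_apply]
  · intro k _ hk
    simp [hk]
  · simp

theorem momentumCoords_ofMomentumCoords {w : Coords n m} (hw : w ∈ c.target) :
    c.momentumCoords (c.ofMomentumCoords w) = w := by
  have h := c.momentumCoords_of_mem (q := c.ofMomentumCoords w) (c.pt_mem hw)
  rw [h, c.momentumComponents_ofMomentumCoords hw]
  change ((c.total (c.pt w)).1, (c.total (c.pt w)).2, w.2.2) = w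
  rw [c.total_pt hw]

theorem momentumCoords_mem {q : Legendre B} (hq : q.1 ∈ c.total.source) :
    c.momentumCoords q ∈ c.target := by
  rw [c.momentumCoords_of_mem hq]
  exact c.total.map_source hq

theorem pt_momentumCoords {q : Legendre B} (hq : q.1 ∈ c.total.source) :
    c.pt (c.momentumCoords q) = q.1 := by
  rw [c.momentumCoords_of_mem hq]
  exact c.total.left_inv hq

theorem ofMomentumCoords_momentumCoords {q : Legendre B} (hq : q.1 ∈ c.total.source) :
    c.ofMomentumCoords (c.momentumCoords q) = q := by
  have hw := c.momentumCoords_mem hq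
  have aux : ∀ (q' : Legendre B) (h : q'.1 = q.1) (hq' : q'.1 ∈ c.total.source),
      c.momentumComponents q' hq' = c.momentumComponents q hq → q' = q := by
    rintro ⟨y', p'⟩ h hq' hc
    obtain ⟨y, p⟩ := q
    dsimp only at h
    subst h
    rw [c.momentumFibre_ext hq hc]
  refine aux _ (c.pt_momentumCoords hq) (c.ofMomentumCoords_mem hw) ?_
  rw [c.momentumComponents_ofMomentumCoords hw, c.momentumCoords_of_mem hq]

/-! ### Transition maps of the Legendre manifold -/

variable (c' : FibredChart B)

theorem isOpen_target : IsOpen c.target :=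
  c.total.open_target.preimage (by fun_prop : Continuous fun a : Coords n m => (a.1, a.2.1))

/-- The coordinate domain over the overlap of two systems of fibred coordinates. -/
def overlap : Set (Coords n m) := {w | w ∈ c.target ∧ c.pt w ∈ c'.total.source}

theorem ofMomentumCoords_mem_of_overlap {w : Coords n m} (hw : w ∈ c.overlap c') :
    (c.ofMomentumCoords w).1 ∈ c'.total.source := hw.2

theorem isOpen_overlap : IsOpen (c.overlap c') := by
  have h := c.total.symm.isOpen_inter_preimage c'.total.open_source
  exact h.preimage (by fun_prop : Continuous fun a : Coords n m => (a.1, a.2.1))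

/-- The transition map of the total space. -/
def totalTransition : (Fin n → ℝ) × (Fin m → ℝ) → (Fin n → ℝ) × (Fin m → ℝ) :=
  c'.total ∘ c.total.symm

/-- The transition map of the base. -/
def baseTransition : (Fin n → ℝ) → (Fin n → ℝ) := c'.base ∘ c.base.symm

theorem contDiffAt_totalTransition {y : Y} (hy : y ∈ c.total.source) (hy' : y ∈ c'.total.source) :
    ContDiffAt ℝ ∞ (c.totalTransition c') (c.total y) := by
  refine ContMDiffAt.contDiffAt (ContMDiffAt.comp (I' := 𝓡 (n + m)) (c.total y) ?_
    (c.smooth_total_symm.contMDiffAt (c.total.open_target.mem_nhds (c.total.map_source hy))))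
  rw [c.total.left_inv hy]
  exact c'.smooth_total.contMDiffAt (c'.total.open_source.mem_nhds hy')

theorem contDiffAt_baseTransition {x : X} (hx : x ∈ c.base.source) (hx' : x ∈ c'.base.source) :
    ContDiffAt ℝ ∞ (c.baseTransition c') (c.base x) := by
  refine ContMDiffAt.contDiffAt (ContMDiffAt.comp (I' := 𝓡 n) (c.base x) ?_
    (c.smooth_base_symm.contMDiffAt (c.base.open_target.mem_nhds (c.base.map_source hx))))
  rw [c.base.left_inv hx]
  exact c'.smooth_base.contMDiffAt (c'.base.open_source.mem_nhds hx')

theorem fderiv_totalTransition {y : Y} (hy : y ∈ c.total.source) (hy' : y ∈ c'.total.source) :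
    fderiv ℝ (c.totalTransition c') (c.total y) = (c'.dTotal y).comp (c.dTotalSymm y) := by
  have h1 : HasMFDerivAt (𝓡 (n + m)) 𝓘(ℝ, (Fin n → ℝ) × (Fin m → ℝ)) c'.total
      (c.total.symm (c.total y)) (c'.dTotal y) := by
    rw [c.total.left_inv hy]; exact c'.hasMFDerivAt_total hy'
  have h2 : HasMFDerivAt 𝓘(ℝ, (Fin n → ℝ) × (Fin m → ℝ)) 𝓘(ℝ, (Fin n → ℝ) × (Fin m → ℝ))
      (c.totalTransition c') (c.total y) ((c'.dTotal y).comp (c.dTotalSymm y)) :=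
    h1.comp _ (c.hasMFDerivAt_total_symm hy)
  have h3 : HasFDerivAt (c.totalTransition c') ((c'.dTotal y).comp (c.dTotalSymm y))
      (c.total y) := hasMFDerivAt_iff_hasFDerivAt.1 h2
  exact h3.fderiv

theorem fderiv_baseTransition {x : X} (hx : x ∈ c.base.source) (hx' : x ∈ c'.base.source) :
    fderiv ℝ (c.baseTransition c') (c.base x) = (c'.dBase x).comp (c.dBaseSymm x) := by
  have h1 : HasMFDerivAt (𝓡 n) 𝓘(ℝ, Fin n → ℝ) c'.base
      (c.base.symm (c.base x)) (c'.dBase x) := by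
    rw [c.base.left_inv hx]; exact c'.hasMFDerivAt_base hx'
  have h2 : HasMFDerivAt 𝓘(ℝ, Fin n → ℝ) 𝓘(ℝ, Fin n → ℝ)
      (c.baseTransition c') (c.base x) ((c'.dBase x).comp (c.dBaseSymm x)) :=
    h1.comp _ (c.hasMFDerivAt_base_symm hx)
  have h3 : HasFDerivAt (c.baseTransition c') ((c'.dBase x).comp (c.dBaseSymm x))
      (c.base x) := hasMFDerivAt_iff_hasFDerivAt.1 h2
  exact h3.fderiv

theorem transition_eq {w : Coords n m} (hw : w ∈ c.overlap c') :
    c.transition c' w = ((c.totalTransition c' (w.1, w.2.1)).1,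
      (c.totalTransition c' (w.1, w.2.1)).2,
      c'.momentumComponents (c.ofMomentumCoords w) (c.ofMomentumCoords_mem_of_overlap c' hw)) :=
  c'.momentumCoords_of_mem (c.ofMomentumCoords_mem_of_overlap c' hw)

/-- The transformation law `p'^μ_j = p^λ_i (∂x'^μ/∂x^λ) (∂y^i/∂y'^j) det(∂x/∂x')` of momenta. -/
theorem momentumComponents_transition {w : Coords n m} (hw : w ∈ c.overlap c') (k : Fin n)
    (j : Fin m) : c'.momentumComponents (c.ofMomentumCoords w) (c.ofMomentumCoords_mem_of_overlap c' hw) k j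
      = (∑ l, ∑ i, w.2.2 l i *
          (fderiv ℝ (c.baseTransition c') w.1 (Pi.single l 1) k *
          (fderiv ℝ (c'.totalTransition c) (c.totalTransition c' (w.1, w.2.1))
            (0, Pi.single j 1)).2 i)) *
        stdVol n (fun l => fderiv ℝ (c'.baseTransition c) (c.baseTransition c' w.1)
          (Pi.single l 1)) := by
  have hwo := hw
  obtain ⟨hw, hw'⟩ := hw
  have hy := c.pt_mem hw
  have hx := c.proj_mem _ hy
  have hx' := c'.proj_mem _ hw'
  have e1 : fderiv ℝ (c.baseTransition c') w.1
      = (c'.dBase (B.proj (c.pt w))).comp (c.dBaseSymm (B.proj (c.pt w))) := by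
    rw [← c.base_proj_pt hw, c.fderiv_baseTransition c' hx hx']
  have e2 : fderiv ℝ (c'.baseTransition c) (c.baseTransition c' w.1)
      = (c.dBase (B.proj (c.pt w))).comp (c'.dBaseSymm (B.proj (c.pt w))) := by
    have : c.baseTransition c' w.1 = c'.base (B.proj (c.pt w)) := by
      rw [← c.base_proj_pt hw]
      exact congrArg c'.base (c.base.left_inv hx)
    rw [this, c'.fderiv_baseTransition c hx' hx]
  have e3 : fderiv ℝ (c'.totalTransition c) (c.totalTransition c' (w.1, w.2.1))
      = (c.dTotal (c.pt w)).comp (c'.dTotalSymm (c.pt w)) :=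
    c'.fderiv_totalTransition c hw' hy
  rw [e1, e2, e3, c'.momentumComponents_eq (c.ofMomentumCoords_mem_of_overlap c' hwo)]
  have h := c.ofMomentumCoords_snd_apply w (c'.homBasis (c.pt w) hw' k j)
  refine (congrArg (c'.density (B.proj (c.pt w))) h).trans ?_
  rw [← c'.densityCLM_apply, map_smul, smul_eq_mul]
  congr 1
  refine Finset.sum_congr rfl fun l _ => Finset.sum_congr rfl fun i _ => ?_
  simp [homComponents_apply, homBasis, verticalFrame, frame]

theorem contDiffAt_transition {w : Coords n m} (hw : w ∈ c.overlap c') :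
    ContDiffAt ℝ ∞ (c.transition c') w := by
  have hy := c.pt_mem hw.1
  have hx := c.proj_mem _ hy
  have hx' := c'.proj_mem _ hw.2
  have hT : ContDiffAt ℝ ∞ (c.totalTransition c') (w.1, w.2.1) := by
    rw [← c.total_pt hw.1]; exact c.contDiffAt_totalTransition c' hy hw.2
  have hT' : ContDiffAt ℝ ∞ (c'.totalTransition c) (c.totalTransition c' (w.1, w.2.1)) :=
    c'.contDiffAt_totalTransition c hw.2 hy
  have hb : ContDiffAt ℝ ∞ (c.baseTransition c') w.1 := by
    rw [← c.base_proj_pt hw.1]; exact c.contDiffAt_baseTransition c' hx hx'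
  have hb' : ContDiffAt ℝ ∞ (c'.baseTransition c) (c.baseTransition c' w.1) := by
    have : c.baseTransition c' w.1 = c'.base (B.proj (c.pt w)) := by
      rw [← c.base_proj_pt hw.1]
      exact congrArg c'.base (c.base.left_inv hx)
    rw [this]; exact c'.contDiffAt_baseTransition c hx' hx
  have p1 : ContDiffAt ℝ ∞ (fun w : Coords n m => (w.1, w.2.1)) w := by fun_prop
  have p2 : ContDiffAt ℝ ∞ (fun w : Coords n m => w.1) w := by fun_prop
  have g1 : ContDiffAt ℝ ∞ (fun w : Coords n m => c.totalTransition c' (w.1, w.2.1)) w :=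
    ContDiffAt.comp (g := c.totalTransition c') w hT p1
  have g2 : ContDiffAt ℝ ∞ (fun w : Coords n m => c.baseTransition c' w.1) w :=
    ContDiffAt.comp (g := c.baseTransition c') w hb p2
  have g3 : ContDiffAt ℝ ∞ (fun w : Coords n m => fderiv ℝ (c.baseTransition c') w.1) w :=
    ContDiffAt.comp w (hb.fderiv_right (m := ∞) (by simp)) p2
  have g4 : ContDiffAt ℝ ∞ (fun w : Coords n m =>
      fderiv ℝ (c'.baseTransition c) (c.baseTransition c' w.1)) w :=
    ContDiffAt.comp w (hb'.fderiv_right (m := ∞) (by simp)) g2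
  have g5 : ContDiffAt ℝ ∞ (fun w : Coords n m =>
      fderiv ℝ (c'.totalTransition c) (c.totalTransition c' (w.1, w.2.1))) w :=
    ContDiffAt.comp w (hT'.fderiv_right (m := ∞) (by simp)) g1
  have g6 : ContDiffAt ℝ ∞ (fun w : Coords n m => stdVol n (fun l =>
      fderiv ℝ (c'.baseTransition c) (c.baseTransition c' w.1) (Pi.single l 1))) w := by
    refine ContDiffAt.comp w (stdVol n).toContinuousMultilinearMap.contDiff.contDiffAt ?_
    exact contDiffAt_pi.2 fun l => g4.clm_apply contDiffAt_const
  have key : ContDiffAt ℝ ∞ (fun w : Coords n m => ((c.totalTransition c' (w.1, w.2.1)).1,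
      (c.totalTransition c' (w.1, w.2.1)).2, fun (k : Fin n) (j : Fin m) =>
      (∑ l, ∑ i, w.2.2 l i *
          (fderiv ℝ (c.baseTransition c') w.1 (Pi.single l 1) k *
          (fderiv ℝ (c'.totalTransition c) (c.totalTransition c' (w.1, w.2.1))
            (0, Pi.single j 1)).2 i)) *
        stdVol n (fun l => fderiv ℝ (c'.baseTransition c) (c.baseTransition c' w.1)
          (Pi.single l 1)))) w := by
    refine g1.fst.prodMk (g1.snd.prodMk (contDiffAt_pi.2 fun k => contDiffAt_pi.2 fun j =>
      ContDiffAt.mul (ContDiffAt.sum fun l _ => ContDiffAt.sum fun i _ => ?_) g6))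
    refine ContDiffAt.mul (by fun_prop) (ContDiffAt.mul ?_ ?_)
    · exact contDiffAt_pi.1 (g3.clm_apply contDiffAt_const) k
    · exact contDiffAt_pi.1 (g5.clm_apply contDiffAt_const).snd i
  refine key.congr_of_eventuallyEq ?_
  filter_upwards [(c.isOpen_overlap c').mem_nhds hw] with z hz
  rw [c.transition_eq c' hz]
  refine Prod.ext rfl (Prod.ext rfl ?_)
  ext k j
  exact c.momentumComponents_transition c' hz k j

/-- The tangent map of a transition map of `Π` lies over that of `Y`. -/
theorem fderiv_transition_total {w : Coords n m} (hw : w ∈ c.overlap c') (v : Coords n m) :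
    ((fderiv ℝ (c.transition c') w v).1, (fderiv ℝ (c.transition c') w v).2.1)
      = c'.dTotal (c.pt w) (c.dTotalSymm (c.pt w) (v.1, v.2.1)) := by
  have hy := c.pt_mem hw.1
  let pr : Coords n m →L[ℝ] (Fin n → ℝ) × (Fin m → ℝ) :=
    (ContinuousLinearMap.fst ℝ _ _).prod
      ((ContinuousLinearMap.fst ℝ _ _).comp (ContinuousLinearMap.snd ℝ _ _))
  have h1 : HasFDerivAt (pr ∘ c.transition c') (pr.comp (fderiv ℝ (c.transition c') w)) w :=
    pr.hasFDerivAt.comp w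
      ((c.contDiffAt_transition c' hw).differentiableAt (by simp)).hasFDerivAt
  have h2 : HasFDerivAt (c.totalTransition c') ((c'.dTotal (c.pt w)).comp (c.dTotalSymm (c.pt w)))
      (pr w) := by
    rw [← c.fderiv_totalTransition c' hy hw.2]
    have : pr w = c.total (c.pt w) := (c.total_pt hw.1).symm
    rw [this]
    exact ((c.contDiffAt_totalTransition c' hy hw.2).differentiableAt (by simp)).hasFDerivAt
  have h3 := h2.comp w pr.hasFDerivAt
  have h4 : pr ∘ c.transition c' =ᶠ[nhds w] c.totalTransition c' ∘ pr := by
    filter_upwards [(c.isOpen_overlap c').mem_nhds hw] with z hz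
    simp only [Function.comp_apply]
    rw [c.transition_eq c' hz]
    rfl
  have := h1.unique (h3.congr_of_eventuallyEq h4)
  exact congrArg (fun f : Coords n m →L[ℝ] (Fin n → ℝ) × (Fin m → ℝ) => f v) this

/-- The tangent map of a transition map of `Π` on vectors tangent to the fibres of `Π → Y`: as the
transition map is linear along the fibres, it is given by the transition map itself. -/
theorem fderiv_transition_vertical {w : Coords n m} (hw : w ∈ c.overlap c')
    (P : Fin n → Fin m → ℝ) :
    fderiv ℝ (c.transition c') w (0, 0, P) = (0, 0, (c.transition c' (w.1, w.2.1, P)).2.2) := by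
  have hd := (c.contDiffAt_transition c' hw).differentiableAt (by simp)
  have hP : ((w.1, w.2.1, P) : Coords n m) ∈ c.overlap c' := hw
  have hlin : ∀ t : ℝ, c.transition c' (w + t • ((0, 0, P) : Coords n m))
      = c.transition c' w + t • (0, 0, (c.transition c' (w.1, w.2.1, P)).2.2) := by
    intro t
    have ht : w + t • ((0, 0, P) : Coords n m) = (w.1, w.2.1, w.2.2 + t • P) := by
      ext <;> simp
    have ht' : ((w.1, w.2.1, w.2.2 + t • P) : Coords n m) ∈ c.overlap c' := hw
    rw [ht, c.transition_eq c' ht', c.transition_eq c' hw, c.transition_eq c' hP]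
    refine Prod.ext (by simp) (Prod.ext (by simp) ?_)
    ext k j
    simp only [c.momentumComponents_transition c' ht', Prod.snd_add, Prod.smul_snd, Pi.add_apply,
      Pi.smul_apply, c.momentumComponents_transition c' hw, c.momentumComponents_transition c' hP,
      smul_eq_mul, add_mul, Finset.sum_add_distrib, mul_assoc, ← Finset.mul_sum]
  rw [← hd.lineDeriv_eq_fderiv, lineDeriv]
  simp only [hlin]
  rw [deriv_const_add, deriv_smul_const (by fun_prop)]
  simp

end FibredChart




namespace LegendreForm

/-! ### The momentum morphism of a Hamiltonian form -/

variable {H : LegendreForm B n}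

theorem contDiffOn_extDeriv (H : LegendreForm B n) (c : FibredChart B) :
    ContDiffOn ℝ ∞ (extDeriv (H.toFun c)) c.target := by
  have h : ContDiffOn ℝ ∞ (fderiv ℝ (H.toFun c)) c.target :=
    (H.smooth c).fderiv_of_isOpen c.isOpen_target (by simp)
  exact (ContinuousAlternatingMap.alternatizeUncurryFinCLM ℝ (Coords n m) ℝ
    (n := n)).contDiff.comp_contDiffOn h

theorem contDiffOn_dHam_dP (H : LegendreForm B n) (c : FibredChart B) (l : Fin n) (i : Fin m) :
    ContDiffOn ℝ ∞ (H.dHam_dP c l i) c.target := by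
  have := (ContinuousAlternatingMap.apply ℝ (Coords n m) ℝ
    (Fin.cons (eP l i) eX : Fin (n + 1) → Coords n m)).contDiff.comp_contDiffOn
      (H.contDiffOn_extDeriv c)
  exact this.neg

/-- The differential of a Hamiltonian form, evaluated on a vector tangent to the fibres of `Π → Y`
and `n` more vectors. -/
theorem extDeriv_cons_vertical (hH : H.IsHamiltonian) (c : FibredChart B) {w : Coords n m}
    (hw : w ∈ c.target) (P : Fin n → Fin m → ℝ) (v : Fin n → Coords n m) :
    extDeriv (H.toFun c) w (Fin.cons (0, 0, P) v)
      = ∑ l, ∑ i, P l i * (dYVol i l v - H.dHam_dP c l i w * vol (n := n) (m := m) v) := by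
  obtain ⟨W, _, hwW, _, g, _, hg⟩ := hH c w hw
  have hγ : ∀ l i, H.dHam_dP c l i w = (g w l).1 i := by
    intro l i
    have h := contractOmega_cons_vertical (g w) (Pi.single l (Pi.single i 1)) (eX (m := m))
    rw [dHam_dP, ← (hg w hwW).2, eP, h, Finset.sum_eq_single l]
    · simp [dYVol_eX, vol_eX, Pi.single_apply]
    · intro k _ hk
      simp [hk]
    · simp
  rw [← (hg w hwW).2, contractOmega_cons_vertical]
  simp only [hγ]

/-- The differentials of the coordinate expressions of a form are related by the transition maps. -/
theorem extDeriv_transition (H : LegendreForm B n) (c c' : FibredChart B) {w : Coords n m}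
    (hw : w ∈ c.overlap c') : extDeriv (H.toFun c) w
      = (extDeriv (H.toFun c') (c.transition c' w)).compContinuousLinearMap
          (fderiv ℝ (c.transition c') w) := by
  have hw' : c.transition c' w ∈ c'.target :=
    c'.momentumCoords_mem (c.ofMomentumCoords_mem_of_overlap c' hw)
  rw [← extDeriv_pullback (r := ∞) (((H.smooth c').contDiffAt
    (c'.isOpen_target.mem_nhds hw')).differentiableAt (by simp)) (c.contDiffAt_transition c' hw)
    (by rw [minSmoothness_of_isRCLikeNormedField]; exact WithTop.coe_le_coe.2 (le_top : (2 : ℕ∞) ≤ ⊤))]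
  refine Filter.EventuallyEq.extDeriv_eq ?_
  filter_upwards [(c.isOpen_overlap c').mem_nhds hw] with z hz
  exact H.pullback c c' z hz.1 hz.2

/-- The jet with coordinates `y^i_λ = ∂ℋ/∂p^λ_i` does not depend on the fibred coordinates. -/
theorem jetAt_dHam_dP_eq (hH : H.IsHamiltonian) (c c' : FibredChart B) (q : Legendre B)
    (hq : q.1 ∈ c.total.source) (hq' : q.1 ∈ c'.total.source) :
    c.jetAt q.1 hq (fun l i => H.dHam_dP c l i (c.momentumCoords q))
      = c'.jetAt q.1 hq' (fun l i => H.dHam_dP c' l i (c'.momentumCoords q)) := by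
  set w := c.momentumCoords q with hw_def
  have hwt : w ∈ c.target := c.momentumCoords_mem hq
  have hpt : c.pt w = q.1 := c.pt_momentumCoords hq
  have hw : w ∈ c.overlap c' := ⟨hwt, by rw [hpt]; exact hq'⟩
  have hτ : c.transition c' w = c'.momentumCoords q := by
    rw [FibredChart.transition, c.ofMomentumCoords_momentumCoords hq]
  have hw' : c'.momentumCoords q ∈ c'.target := c'.momentumCoords_mem hq'
  have hx := c.proj_mem _ hq
  have hx' := c'.proj_mem _ hq'
  set j' := c'.jetAt q.1 hq' (fun l i => H.dHam_dP c' l i (c'.momentumCoords q)) with hj'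
  -- the jet that is flat in the coordinates `c`
  set j₀ := c.jetAt q.1 hq 0 with hj₀
  -- the horizontal vectors, flat in the coordinates `c`, over the coordinate vectors of `c'`
  let v : Fin n → Coords n m := fun k => (c.dBase (B.proj q.1) (c'.frame (B.proj q.1) k), 0, 0)
  have hv : ∀ k, ((fderiv ℝ (c.transition c') w (v k)).1 = Pi.single k 1) ∧
      (fderiv ℝ (c.transition c') w (v k)).2.1 = c'.jetComponents ⟨q.1, j₀⟩ k := by
    intro k
    have h1 := c.fderiv_transition_total c' hw (v k)
    have h2 : c.dTotalSymm q.1 ((v k).1, (v k).2.1) = j₀.1 (c'.frame (B.proj q.1) k) := by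
      apply c.dTotal_injective hq
      rw [hj₀, c.dTotal_jetAt hq, c.dTotal_dTotalSymm hq]
      simp [v]
    rw [hpt, h2, c'.dTotal_jet_frame hq'] at h1
    exact ⟨congrArg Prod.fst h1, congrArg Prod.snd h1⟩
  -- the Jacobian determinant `det(∂x/∂x')`
  set δ := c'.density (B.proj q.1) (c.volAt (B.proj q.1)) with hδ_def
  have hδ : δ ≠ 0 := by
    intro h0
    have h := c'.eq_density_smul_volAt hx' (c.volAt (B.proj q.1))
    rw [← hδ_def, h0, zero_smul] at h
    have := c.density_volAt hx
    rw [h] at this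
    exact zero_ne_one this
  have hvol : vol (n := n) (m := m) v = δ := rfl
  have hdY : ∀ i l, dYVol i l v = 0 := fun i l => by simp [dYVol_apply, v]
  have hvol' : vol (n := n) (m := m) (fun k => fderiv ℝ (c.transition c') w (v k)) = 1 := by
    rw [← vol_eX (n := n) (m := m), vol_apply, vol_apply]
    simp only [hv, eX]
  have hdY' : ∀ i l, dYVol i l (fun k => fderiv ℝ (c.transition c') w (v k))
      = c'.jetComponents ⟨q.1, j₀⟩ l i := by
    intro i l
    rw [dYVol_of_fst_eq i l _ fun k => (hv k).1, (hv l).2]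
  -- the pairing of a momentum with the difference of the jets `j₀` and `j'`
  have hpair : ∀ P : Fin n → Fin m → ℝ,
      ∑ l, ∑ i, (c.transition c' (w.1, w.2.1, P)).2.2 l i
        * c'.homComponents q.1 (j₀.diff j') l i
      = (∑ l, ∑ i, P l i * c.homComponents q.1 (j₀.diff j') l i) * δ := by
    intro P
    have hwP : ((w.1, w.2.1, P) : Coords n m) ∈ c.overlap c' := hw
    have aux : ∀ (y : Y) (hy : y ∈ c'.total.source) (h : c.pt (w.1, w.2.1, P) = y)
        (σ : EuclideanSpace ℝ (Fin n) →L[ℝ] B.vertical y),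
        ∑ l, ∑ i, (c.transition c' (w.1, w.2.1, P)).2.2 l i * c'.homComponents y σ l i
          = (∑ l, ∑ i, P l i * c.homComponents y σ l i)
            * c'.density (B.proj y) (c.volAt (B.proj y)) := by
      intro y hy h σ
      subst h
      have h1 := c'.momentum_pairing (c.ofMomentumCoords_mem_of_overlap c' hwP) σ
      have h2 := c.ofMomentumCoords_snd_apply (w.1, w.2.1, P) σ
      have h3 := congrArg (c'.densityCLM (B.proj (c.pt (w.1, w.2.1, P)))) (h1.symm.trans h2)
      rw [c.transition_eq c' hwP]
      have h4 : c'.density (B.proj (c.pt (w.1, w.2.1, P)))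
          (c'.volAt (B.proj (c.pt (w.1, w.2.1, P)))) = 1 := c'.density_volAt (c'.proj_mem _ hy)
      refine Eq.trans ?_ (h3.trans ?_)
      · refine Eq.trans ?_ (map_smul _ _ _).symm
        refine (mul_one _).symm.trans ?_
        exact congrArg _ h4.symm
      · rw [map_smul]
        rfl
    exact aux q.1 hq' hpt _
  -- the two expressions of `dH`, evaluated on `(0, 0, P)` and the vectors `v`
  have key : ∀ P : Fin n → Fin m → ℝ,
      ∑ l, ∑ i, P l i * H.dHam_dP c l i w
        = ∑ l, ∑ i, P l i * c.jetComponents ⟨q.1, j'⟩ l i := by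
    intro P
    have h1 := H.extDeriv_cons_vertical hH c hwt P v
    rw [H.extDeriv_transition c c' hw, hτ] at h1
    have h2 : (fderiv ℝ (c.transition c') w) ∘ (Fin.cons (0, 0, P) v : Fin (n + 1) → Coords n m)
        = Fin.cons (0, 0, (c.transition c' (w.1, w.2.1, P)).2.2)
          (fun k => fderiv ℝ (c.transition c') w (v k)) := by
      funext k
      refine Fin.cases ?_ (fun k => ?_) k
      · exact c.fderiv_transition_vertical c' hw P
      · rfl
    have h3 := H.extDeriv_cons_vertical hH c' hw' (c.transition c' (w.1, w.2.1, P)).2.2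
      (fun k => fderiv ℝ (c.transition c') w (v k))
    rw [ContinuousAlternatingMap.compContinuousLinearMap_apply, h2, h3] at h1
    have h4 := hpair P
    rw [c.homComponents_diff, c'.homComponents_diff, hj', c'.jetComponents_jetAt hq', ← hj',
      hj₀, c.jetComponents_jetAt hq, ← hj₀] at h4
    simp only [hvol', hdY', hvol, hdY, mul_one, zero_sub] at h1
    simp only [Pi.sub_apply, Pi.zero_apply, zero_sub] at h4
    rw [h4] at h1
    apply mul_right_cancel₀ hδ
    simp only [mul_neg, Finset.sum_neg_distrib, neg_mul, ← mul_assoc, ← Finset.sum_mul] at h1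
    exact (neg_injective h1).symm
  have key' : c.jetComponents ⟨q.1, j'⟩ = fun l i => H.dHam_dP c l i w := by
    ext l i
    have := key (Pi.single l (Pi.single i 1))
    rw [Finset.sum_eq_single l, Finset.sum_eq_single l] at this
    · simpa [Pi.single_apply] using this.symm
    all_goals simp +contextual
  rw [← key', c.jetAt_jetComponents hq]

variable [IsManifold (𝓡 n) ∞ X] [IsManifold (𝓡 (n + m)) ∞ Y]

theorem momentumMorphism_snd (hH : H.IsHamiltonian) (c : FibredChart B) {q : Legendre B}
    (hq : q.1 ∈ c.total.source) : (H.momentumMorphism q).2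
      = c.jetAt q.1 hq (fun l i => H.dHam_dP c l i (c.momentumCoords q)) :=
  H.jetAt_dHam_dP_eq hH _ c q (exists_fibredChart B q.1).choose_spec hq

/-- The momentum morphism in fibred coordinates: `y^i_λ ∘ Ĥ = ∂ℋ/∂p^λ_i`. -/
theorem jetCoords_momentumMorphism (hH : H.IsHamiltonian) (c : FibredChart B) {q : Legendre B}
    (hq : q.1 ∈ c.total.source) : c.jetCoords (H.momentumMorphism q)
      = ((c.momentumCoords q).1, (c.momentumCoords q).2.1,
        fun l i => H.dHam_dP c l i (c.momentumCoords q)) := by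
  have h : c.jetComponents (H.momentumMorphism q)
      = fun l i => H.dHam_dP c l i (c.momentumCoords q) := by
    have e : H.momentumMorphism q = ⟨q.1, (H.momentumMorphism q).2⟩ := rfl
    rw [e, H.momentumMorphism_snd hH c hq, c.jetComponents_jetAt hq]
  rw [FibredChart.jetCoords, h, c.momentumCoords_of_mem hq]
  rfl

end LegendreForm

namespace FibredChart

theorem jetCoords_mem (c : FibredChart B) {j : Jet B} (hj : j.1 ∈ c.total.source) :
    c.jetCoords j ∈ c.target :=
  c.total.map_source hj

end FibredChart

namespace Lagrangian

/-! ### The Legendre morphism in fibred coordinates -/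

variable (L : Lagrangian B) (c : FibredChart B)

theorem coordFun_jetCoords {j : Jet B} (hj : j.1 ∈ c.total.source) :
    L.coordFun c (c.jetCoords j) = c.density (B.proj j.1) (L.toFun j) := by
  have hmem := c.jetCoords_mem hj
  have hpt : c.pt (c.jetCoords j) = j.1 := c.total.left_inv hj
  rw [coordFun, densityCoordFun, dif_pos hmem]
  have aux : ∀ (y : Y) (hy : y ∈ c.total.source) (_ : y = j.1),
      c.density (B.proj y) (L.toFun ⟨y, c.jetAt y hy (c.jetComponents j)⟩)
        = c.density (B.proj j.1) (L.toFun j) := by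
    intro y hy h
    subst h
    rw [c.jetAt_jetComponents hy]
  exact aux _ (c.pt_mem hmem) hpt

theorem contDiffAt_coordFun {a : Coords n m} (ha : a ∈ c.target) :
    ContDiffAt ℝ ∞ (L.coordFun c) a :=
  (L.smooth c).contDiffAt (c.isOpen_target.mem_nhds ha)

theorem contDiffAt_momentum {a : Coords n m} (ha : a ∈ c.target) (l : Fin n) (i : Fin m) :
    ContDiffAt ℝ ∞ (L.momentum c l i) a :=
  ((L.contDiffAt_coordFun c ha).fderiv_right (m := ∞) (by simp)).clm_apply contDiffAt_const

/-- The Legendre morphism in fibred coordinates: `p^λ_i ∘ L̂ = ∂ℒ/∂y^i_λ`. -/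
theorem momentumCoords_legendre {j : Jet B} (hj : j.1 ∈ c.total.source) :
    c.momentumCoords (L.legendre j) = ((c.jetCoords j).1, (c.jetCoords j).2.1,
      fun l i => L.momentum c l i (c.jetCoords j)) := by
  have hx := c.proj_mem _ hj
  have hj' : (L.legendre j).1 ∈ c.total.source := hj
  rw [c.momentumCoords_of_mem hj']
  refine Prod.ext rfl (Prod.ext rfl ?_)
  ext l i
  have hG : (fun σ : EuclideanSpace ℝ (Fin n) →L[ℝ] B.vertical j.1 =>
      L.toFun ⟨j.1, j.2.addVertical σ⟩)
      = fun σ => L.coordFun c (c.jetCoords j + (0, 0, c.homComponents j.1 σ)) •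
        c.volAt (B.proj j.1) := by
    funext σ
    rw [c.eq_density_smul_volAt hx (L.toFun ⟨j.1, j.2.addVertical σ⟩)]
    have h1 := L.coordFun_jetCoords c (j := ⟨j.1, j.2.addVertical σ⟩) hj
    have h2 : c.jetCoords ⟨j.1, j.2.addVertical σ⟩
        = c.jetCoords j + (0, 0, c.homComponents j.1 σ) := by
      have h := c.jetComponents_addVertical j.1 j.2 σ
      rw [FibredChart.jetCoords, h]
      simp [FibredChart.jetCoords]
    rw [h2] at h1
    rw [h1]
  have hd : HasFDerivAt (L.coordFun c) (fderiv ℝ (L.coordFun c) (c.jetCoords j))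
      (c.jetCoords j + (0, 0, c.homComponents j.1 0)) := by
    have : c.jetCoords j + (0, 0, c.homComponents j.1 0) = c.jetCoords j := by
      rw [map_zero]
      exact add_zero _
    rw [this]
    exact ((L.contDiffAt_coordFun c (c.jetCoords_mem hj)).differentiableAt (by simp)).hasFDerivAt
  let A : (EuclideanSpace ℝ (Fin n) →L[ℝ] B.vertical j.1) →L[ℝ] Coords n m :=
    (0 : _ →L[ℝ] (Fin n → ℝ)).prod ((0 : _ →L[ℝ] (Fin m → ℝ)).prod (c.homComponents j.1))
  have hA : HasFDerivAt (fun σ => c.jetCoords j + (0, 0, c.homComponents j.1 σ)) A 0 := by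
    have h : HasFDerivAt (fun σ => ((0, 0, c.homComponents j.1 σ) : Coords n m)) A 0 :=
      A.hasFDerivAt
    exact HasFDerivAt.const_add (𝕜 := ℝ) (E := EuclideanSpace ℝ (Fin n) →L[ℝ] B.vertical j.1)
      (F := Coords n m) (f' := A) (x := 0) (c.jetCoords j) h
  have hfd := ((HasFDerivAt.comp (f := fun σ => c.jetCoords j + (0, 0, c.homComponents j.1 σ)) (f' := A)
    (g := L.coordFun c) 0 hd hA).smul_const (c.volAt (B.proj j.1))).fderiv
  change c.density (B.proj j.1) (fderiv ℝ (fun σ : EuclideanSpace ℝ (Fin n) →L[ℝ] B.vertical j.1 =>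
    L.toFun ⟨j.1, j.2.addVertical σ⟩) 0 (c.homBasis j.1 hj l i)) = _
  rw [hG]
  have hfd' := congrArg (fun f => c.densityCLM (B.proj j.1) (f (c.homBasis j.1 hj l i))) hfd
  refine hfd'.trans ?_
  dsimp only
  rw [ContinuousLinearMap.smulRight_apply, map_smul, c.densityCLM_apply, c.density_volAt hx,
    smul_eq_mul, mul_one, ContinuousLinearMap.comp_apply]
  have : A (c.homBasis j.1 hj l i) = eP l i := by
    simp [A, eP, c.homComponents_homBasis hj]
  rw [this]
  rfl

theorem fderiv_coordFun_vertical (a : Coords n m) (V : Fin n → Fin m → ℝ) :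
    fderiv ℝ (L.coordFun c) a (0, 0, V) = ∑ l, ∑ i, V l i * L.momentum c l i a := by
  have : ((0, 0, V) : Coords n m) = ∑ l, ∑ i, V l i • eP l i := by
    refine Prod.ext ?_ (Prod.ext ?_ ?_)
    · simp [Prod.fst_sum, eP]
    · simp [Prod.fst_sum, Prod.snd_sum, eP]
    · ext k j
      simp only [Prod.snd_sum, eP, Prod.smul_snd]
      rw [Finset.sum_apply, Finset.sum_apply, Finset.sum_eq_single k]
      · simp [Finset.sum_apply, Pi.single_apply]
      · intro l _ hl
        simp [Finset.sum_apply, hl.symm]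
      · simp
  rw [this]
  simp [map_sum, momentum]

end Lagrangian

namespace LegendreForm

/-! ### Associated Hamiltonian forms on the constraint space -/

variable {H : LegendreForm B n} {L : Lagrangian B}
  [IsManifold (𝓡 n) ∞ X] [IsManifold (𝓡 (n + m)) ∞ Y]

/-- On the constraint space, `∂_i ℋ = -∂_i ℒ ∘ Ĥ`: the derivative of `p^λ_i Ĥ^i_λ - ℒ ∘ Ĥ` through
`Ĥ` vanishes there, since `p^λ_i = ∂ℒ/∂y^i_λ ∘ Ĥ`. -/
theorem dHam_dY_of_mem_constraintSpace (hH : H.IsHamiltonian) (hHL : H.IsAssociated L)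
    (c : FibredChart B) {q : Legendre B} (hq : q.1 ∈ c.total.source)
    (hqL : q ∈ L.constraintSpace) (i : Fin m) :
    H.dHam_dY c i (c.momentumCoords q)
      = -fderiv ℝ (L.coordFun c) (c.jetCoords (H.momentumMorphism q)) (eY i) := by
  set w := c.momentumCoords q with hw_def
  have hw : w ∈ c.target := c.momentumCoords_mem hq
  let φ : Coords n m → Fin n → Fin m → ℝ := fun z l i => H.dHam_dP c l i z
  let ψ : Coords n m → Coords n m := fun z => (z.1, z.2.1, φ z)
  have hψ : ψ w = c.jetCoords (H.momentumMorphism q) := (H.jetCoords_momentumMorphism hH c hq).symm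
  have hψt : ∀ {z}, z ∈ c.target → ψ z ∈ c.target := fun hz => hz
  have hp : ∀ l i, w.2.2 l i = L.momentum c l i (ψ w) := by
    intro l i
    have h1 : (H.momentumMorphism q).1 ∈ c.total.source := hq
    have h2 := L.momentumCoords_legendre c h1
    rw [hHL.1 q hqL, ← hψ] at h2
    exact congrArg (fun a : Coords n m => a.2.2 l i) h2
  let h : Coords n m → ℝ := fun z => (∑ l, ∑ i, z.2.2 l i * φ z l i) - L.coordFun c (ψ z)
  have hφd : DifferentiableAt ℝ φ w :=
    differentiableAt_pi.2 fun l => differentiableAt_pi.2 fun i =>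
      ((H.contDiffOn_dHam_dP c l i).contDiffAt (c.isOpen_target.mem_nhds hw)).differentiableAt
        (by simp)
  have hφ : HasFDerivAt φ (fderiv ℝ φ w) w := hφd.hasFDerivAt
  have hψd : HasFDerivAt ψ ((ContinuousLinearMap.fst ℝ _ _).prod
      (((ContinuousLinearMap.fst ℝ _ _).comp (ContinuousLinearMap.snd ℝ _ _)).prod
        (fderiv ℝ φ w))) w :=
    ((ContinuousLinearMap.fst ℝ (Fin n → ℝ)
      ((Fin m → ℝ) × (Fin n → Fin m → ℝ))).hasFDerivAt (x := w)).prodMk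
      ((ContinuousLinearMap.hasFDerivAt
        ((ContinuousLinearMap.fst ℝ (Fin m → ℝ) (Fin n → Fin m → ℝ)).comp
          (ContinuousLinearMap.snd ℝ (Fin n → ℝ) _))).prodMk hφ)
  have hL : HasFDerivAt (L.coordFun c) (fderiv ℝ (L.coordFun c) (ψ w)) (ψ w) :=
    ((L.contDiffAt_coordFun c (hψt hw)).differentiableAt (by simp)).hasFDerivAt
  have hφli : ∀ l i, HasFDerivAt (fun z => φ z l i)
      ((ContinuousLinearMap.proj (R := ℝ) (φ := fun _ : Fin m => ℝ) i).comp
        ((ContinuousLinearMap.proj (R := ℝ) (φ := fun _ : Fin n => Fin m → ℝ) l).comp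
          (fderiv ℝ φ w))) w := fun l i =>
    hasFDerivAt_pi'.1 (hasFDerivAt_pi'.1 hφ l) i
  have hsum := HasFDerivAt.fun_sum (u := Finset.univ) fun l _ =>
    HasFDerivAt.fun_sum (u := Finset.univ) fun i _ =>
      ((dP (n := n) (m := m) l i).hasFDerivAt (x := w)).mul (hφli l i)
  have hh : HasFDerivAt h _ w := hsum.sub (hL.comp w hψd)
  -- `associatedExpr` is written with `Ĥ`; on the whole coordinate domain `Ĥ^i_λ = φ`, so that the
  -- associated expression has the differentiable Hamiltonian `h`
  have hext : extDeriv (H.toFun c) w = extDeriv (fun z => liouville z - h z • vol) w := by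
    rw [hHL.2 c w hw]
    refine Filter.EventuallyEq.extDeriv_eq ?_
    filter_upwards [c.isOpen_target.mem_nhds hw] with z hz
    have hz' := c.ofMomentumCoords_mem hz
    have h1 := H.jetCoords_momentumMorphism hH c hz'
    rw [c.momentumCoords_ofMomentumCoords hz] at h1
    have h2 : c.jetComponents (H.momentumMorphism (c.ofMomentumCoords z)) = φ z :=
      congrArg (fun a : Coords n m => a.2.2) h1
    have h3 := L.coordFun_jetCoords c (j := H.momentumMorphism (c.ofMomentumCoords z)) hz'
    rw [h1] at h3
    simp only [associatedExpr, h2, ← h3, h, ψ, φ]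
  rw [H.dHam_dY_eq hh.differentiableAt hext, hh.fderiv, ← hψ]
  -- the derivatives through `φ` in the two terms of `h` cancel by `hp`
  have hsplit : ((0, Pi.single i 1, fderiv ℝ φ w (eY i)) : Coords n m)
      = eY i + (0, 0, fderiv ℝ φ w (eY i)) := by
    simp [eY]
  have hψe : (ContinuousLinearMap.fst ℝ (Fin n → ℝ) ((Fin m → ℝ) × (Fin n → Fin m → ℝ))).prod
      (((ContinuousLinearMap.fst ℝ (Fin m → ℝ) (Fin n → Fin m → ℝ)).comp
        (ContinuousLinearMap.snd ℝ (Fin n → ℝ) _)).prod (fderiv ℝ φ w)) (eY i)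
      = (0, Pi.single i 1, fderiv ℝ φ w (eY i)) := rfl
  rw [sub_apply, ContinuousLinearMap.comp_apply, hψe, hsplit, map_add,
    L.fderiv_coordFun_vertical]
  simp only [← hp]
  simp [dP, eY, mul_comm]

end LegendreForm



variable {U : Set X}

/-! ### Sections in fibred coordinates -/

theorem FibredChart.isOpen_sectionDomain (c : FibredChart B) (hU : IsOpen U) {s : X → Y}
    (hs : ContinuousOn s U) : IsOpen (c.sectionDomain U s) := by
  have h := hs.isOpen_inter_preimage hU c.total.open_source
  have h2 := c.base.symm.isOpen_inter_preimage h
  exact h2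

theorem IsSection.total_fst {s : X → Y} (hs : IsSection B U s) {c : FibredChart B}
    {u : Fin n → ℝ} (hu : u ∈ c.sectionDomain U s) : (c.total (s (c.base.symm u))).1 = u := by
  rw [c.fst_total _ hu.2.2, hs.1 _ hu.2.1, c.base.right_inv hu.1]

theorem IsSection.congr {s s' : X → Y} (hs : IsSection B U s) (h : ∀ x ∈ U, s' x = s x) :
    IsSection B U s' :=
  ⟨fun x hx => by rw [h x hx, hs.1 x hx], hs.2.congr h⟩

theorem FibredChart.sectionDomain_congr (c : FibredChart B) {s s' : X → Y}
    (h : ∀ x ∈ U, s' x = s x) : c.sectionDomain U s' = c.sectionDomain U s := by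
  ext u
  refine and_congr_right fun _ => and_congr_right fun hu => ?_
  rw [h _ hu]

theorem IsJetSection.isLegendreSection {L : Lagrangian B} {r : X → Legendre B} {sbar : X → Jet B}
    (hs : IsJetSection U sbar)
    (hr : ∀ x ∈ U, r x = L.legendre (sbar x)) : IsLegendreSection U r := by
  have h1 : ∀ x ∈ U, (r x).1 = (sbar x).1 := fun x hx => by rw [hr x hx]; rfl
  refine ⟨hs.1.congr h1, fun c => ?_⟩
  rw [c.sectionDomain_congr h1]
  have ha := hs.2 c
  have key : ContDiffOn ℝ ∞ (fun u => (((c.jetCoords (sbar (c.base.symm u))).1,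
      (c.jetCoords (sbar (c.base.symm u))).2.1,
      fun l i => L.momentum c l i (c.jetCoords (sbar (c.base.symm u)))) : Coords n m))
      (c.sectionDomain U fun x => (sbar x).1) := by
    refine ha.fst.prodMk (ha.snd.fst.prodMk (contDiffOn_pi.2 fun l => contDiffOn_pi.2 fun i =>
      fun u hu => ?_))
    exact (L.contDiffAt_momentum c (c.jetCoords_mem hu.2.2) l i).comp_contDiffWithinAt u (ha u hu)
  refine key.congr fun u hu => ?_
  rw [hr _ hu.2.1, L.momentumCoords_legendre c hu.2.2]

/-- Along a solution of the first order equations `s̄^i_λ = ∂_λ s^i` and `∂_λ s̄^i_μ = ∂_λ ∂_μ s^i`. -/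
theorem FirstOrderEulerLagrange.secondOrder {L : Lagrangian B} {sbar : X → Jet B} (hU : IsOpen U) (hs : IsJetSection U sbar)
    (hEL : FirstOrderEulerLagrange U L sbar) {s : X → Y} (hss : ∀ x ∈ U, s x = (sbar x).1) :
    SecondOrderEulerLagrange U L s := by
  intro c u hu
  rw [c.sectionDomain_congr hss] at hu
  have hD := c.isOpen_sectionDomain hU hs.1.2.continuousOn
  set b : (Fin n → ℝ) → Coords n m := fun u => c.jetCoords (sbar (c.base.symm u)) with hb_def
  have hbd : ∀ v ∈ c.sectionDomain U (fun x => (sbar x).1), HasFDerivAt b (fderiv ℝ b v) v :=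
    fun v hv => (((hs.2 c).contDiffAt (hD.mem_nhds hv)).differentiableAt (by simp)).hasFDerivAt
  have hf : ∀ v ∈ c.sectionDomain U (fun x => (sbar x).1),
      (fun u => (c.total (s (c.base.symm u))).2) =ᶠ[nhds v] fun u => (b u).2.1 := by
    intro v hv
    filter_upwards [hD.mem_nhds hv] with z hz
    rw [hss _ hz.2.1]
    rfl
  have hdf : ∀ k, ∀ v ∈ c.sectionDomain U (fun x => (sbar x).1),
      fderiv ℝ (fun u => (c.total (s (c.base.symm u))).2) v (Pi.single k 1) = (b v).2.2 k := by
    intro k v hv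
    rw [(hf v hv).fderiv_eq, (hbd v hv).snd.fst.fderiv]
    exact funext ((hEL c v hv).1 k)
  have hddf : ∀ k l, fderiv ℝ (fun v => fderiv ℝ (fun u => (c.total (s (c.base.symm u))).2) v
      (Pi.single k 1)) u (Pi.single l 1) = (fderiv ℝ b u (Pi.single l 1)).2.2 k := by
    intro k l
    have h1 : (fun v => fderiv ℝ (fun u => (c.total (s (c.base.symm u))).2) v (Pi.single k 1))
        =ᶠ[nhds u] fun v => (b v).2.2 k := by
      filter_upwards [hD.mem_nhds hu] with v hv
      exact hdf k v hv
    rw [h1.fderiv_eq, (hasFDerivAt_pi'.1 (hbd u hu).snd.snd k).fderiv]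
    rfl
  have hbu : ((u, (c.total (s (c.base.symm u))).2, fun k => (b u).2.2 k) : Coords n m) = b u :=
    Prod.ext (hs.1.total_fst hu).symm (Prod.ext (hf u hu).self_of_nhds rfl)
  intro f df a i
  have h := (hEL c u hu).2 i
  have ha : a = b u := by
    refine Eq.trans ?_ hbu
    exact Prod.ext rfl (Prod.ext rfl (funext fun k => hdf k u hu))
  have hdf' : ∀ l, df l u = (b u).2.2 l := fun l => hdf l u hu
  have hddf' : ∀ k l, fderiv ℝ (df k) u (Pi.single l 1) = (fderiv ℝ b u (Pi.single l 1)).2.2 k :=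
    hddf
  simp only [ha, hdf', hddf']
  exact h

/-! ### Corresponding sections of `Π` and of `J¹Y` -/

variable [IsManifold (𝓡 n) ∞ X] [IsManifold (𝓡 (n + m)) ∞ Y]

section Correspondence

variable {H : LegendreForm B n} {L : Lagrangian B} {r : X → Legendre B} {sbar : X → Jet B}

theorem IsLegendreSection.isJetSection (hH : H.IsHamiltonian)
    (hr : IsLegendreSection U r) (hs : ∀ x ∈ U, sbar x = H.momentumMorphism (r x)) :
    IsJetSection U sbar := by
  have h1 : ∀ x ∈ U, (sbar x).1 = (r x).1 := fun x hx => by rw [hs x hx]; rfl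
  refine ⟨hr.1.congr h1, fun c => ?_⟩
  rw [c.sectionDomain_congr h1]
  have ha := hr.2 c
  have hmap : Set.MapsTo (fun u => c.momentumCoords (r (c.base.symm u)))
      (c.sectionDomain U fun x => (r x).1) c.target := fun u hu => c.momentumCoords_mem hu.2.2
  have key : ContDiffOn ℝ ∞ (fun u => (((c.momentumCoords (r (c.base.symm u))).1,
      (c.momentumCoords (r (c.base.symm u))).2.1,
      fun l i => H.dHam_dP c l i (c.momentumCoords (r (c.base.symm u)))) : Coords n m))
      (c.sectionDomain U fun x => (r x).1) :=
    ha.fst.prodMk (ha.snd.fst.prodMk (contDiffOn_pi.2 fun l => contDiffOn_pi.2 fun i =>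
      (H.contDiffOn_dHam_dP c l i).comp ha hmap))
  refine key.congr fun u hu => ?_
  rw [hs _ hu.2.1, H.jetCoords_momentumMorphism hH c hu.2.2]

/-- If a jet section and a Legendre section correspond to each other under both `Ĥ` and `L̂`, then
the first order Euler-Lagrange equations for the former are the Hamilton equations for the latter:
in coordinates `s̄^i_λ = ∂ℋ/∂p^λ_i`, `p^λ_i = ∂ℒ/∂y^i_λ` and `∂_i ℋ = -∂_i ℒ`. -/
theorem hamiltonEquations_iff (hH : H.IsHamiltonian) (hHL : H.IsAssociated L) (hU : IsOpen U)
    (hrs : IsLegendreSection U r) (hss : IsJetSection U sbar)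
    (hs : ∀ x ∈ U, sbar x = H.momentumMorphism (r x)) (hr : ∀ x ∈ U, r x = L.legendre (sbar x)) :
    H.HamiltonEquations U r ↔ FirstOrderEulerLagrange U L sbar := by
  have h1 : ∀ x ∈ U, (sbar x).1 = (r x).1 := fun x hx => by rw [hs x hx]; rfl
  refine forall_congr' fun c => ?_
  have hDeq := c.sectionDomain_congr h1
  rw [hDeq]
  refine forall₂_congr fun u hu => ?_
  have hD : IsOpen (c.sectionDomain U fun x => (r x).1) :=
    c.isOpen_sectionDomain hU hrs.1.2.continuousOn
  set a : (Fin n → ℝ) → Coords n m := fun u => c.momentumCoords (r (c.base.symm u)) with ha_def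
  set b : (Fin n → ℝ) → Coords n m := fun u => c.jetCoords (sbar (c.base.symm u)) with hb_def
  have hyb : ∀ {v}, v ∈ c.sectionDomain U (fun x => (r x).1) →
      (sbar (c.base.symm v)).1 ∈ c.total.source := fun hv => by rw [h1 _ hv.2.1]; exact hv.2.2
  have hb : HasFDerivAt b (fderiv ℝ b u) u :=
    (((hDeq ▸ hss.2 c).contDiffAt (hD.mem_nhds hu)).differentiableAt (by simp)).hasFDerivAt
  have hbu : b u ∈ c.target := c.jetCoords_mem (hyb hu)
  have hab : a =ᶠ[nhds u] fun v => ((b v).1, (b v).2.1, fun k i => L.momentum c k i (b v)) := by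
    filter_upwards [hD.mem_nhds hu] with v hv
    simp only [ha_def, hb_def]
    rw [hr _ hv.2.1, L.momentumCoords_legendre c (hyb hv)]
  have hmom : HasFDerivAt (fun v k i => L.momentum c k i (b v))
      (ContinuousLinearMap.pi fun k => ContinuousLinearMap.pi fun i =>
        (fderiv ℝ (L.momentum c k i) (b u)).comp (fderiv ℝ b u)) u :=
    hasFDerivAt_pi.2 fun k => hasFDerivAt_pi.2 fun i =>
      ((L.contDiffAt_momentum c hbu k i).differentiableAt (by simp)).hasFDerivAt.comp u hb
  have ha := (hb.fst.prodMk (hb.snd.fst.prodMk hmom)).congr_of_eventuallyEq hab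
  have hfst : ∀ l, (fderiv ℝ b u (Pi.single l 1)).1 = Pi.single l 1 := by
    intro l
    have h2 : (fun v => (b v).1) =ᶠ[nhds u] id := by
      filter_upwards [hD.mem_nhds hu] with v hv
      exact hss.1.total_fst (c := c) (by rw [hDeq]; exact hv)
    have h3 := hb.fst.unique ((hasFDerivAt_id u).congr_of_eventuallyEq h2)
    exact congrArg (fun f : (Fin n → ℝ) →L[ℝ] (Fin n → ℝ) => f (Pi.single l 1)) h3
  have hP : ∀ l i, H.dHam_dP c l i (a u) = (b u).2.2 l i := by
    intro l i
    simp only [ha_def, hb_def]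
    rw [hs _ hu.2.1, H.jetCoords_momentumMorphism hH c hu.2.2]
  have hY : ∀ i, -H.dHam_dY c i (a u) = fderiv ℝ (L.coordFun c) (b u) (eY i) := by
    intro i
    have hQ : r (c.base.symm u) ∈ L.constraintSpace := ⟨_, (hr _ hu.2.1).symm⟩
    simp only [ha_def, hb_def]
    rw [H.dHam_dY_of_mem_constraintSpace hH hHL c hu.2.2 hQ i, neg_neg, ← hs _ hu.2.1]
  have ha21 : ∀ l i, (fderiv ℝ a u (Pi.single l 1)).2.1 i = (fderiv ℝ b u (Pi.single l 1)).2.1 i :=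
    fun l i => by rw [ha.fderiv]; rfl
  have ha22 : ∀ l k i, (fderiv ℝ a u (Pi.single l 1)).2.2 k i
      = fderiv ℝ (L.momentum c k i) (b u) (fderiv ℝ b u (Pi.single l 1)) :=
    fun l k i => by rw [ha.fderiv]; rfl
  dsimp only
  simp only [ha21, ha22, hP, hY]
  refine and_congr_right fun hEL => forall_congr' fun i => ?_
  have hb' : ∀ l, fderiv ℝ b u (Pi.single l 1)
      = (Pi.single l 1, (b u).2.2 l, (fderiv ℝ b u (Pi.single l 1)).2.2) := fun l =>
    Prod.ext (hfst l) (Prod.ext (funext (hEL l)) rfl)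
  simp only [← hb']
  rw [sub_eq_zero, eq_comm]

end Correspondence

/-! ### Holonomy of solutions -/

variable {L : Lagrangian B} {sbar : X → Jet B}

/-- Solutions of the first order Euler-Lagrange equations are jet prolongations, by
`∂_λ s̄^i = s̄^i_λ`. -/
theorem FirstOrderEulerLagrange.isJetProlongation (hU : IsOpen U) (hs : IsJetSection U sbar)
    (hEL : FirstOrderEulerLagrange U L sbar) {s : X → Y} (hss : ∀ x ∈ U, s x = (sbar x).1) :
    IsJetProlongation U s sbar := by
  intro x hx
  refine ⟨(hss x hx).symm, ?_⟩
  have hev : s =ᶠ[nhds x] fun x => (sbar x).1 := by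
    filter_upwards [hU.mem_nhds hx] with z hz using hss z hz
  rw [hev.mfderiv_eq]
  clear hev hss
  set s : X → Y := fun x => (sbar x).1 with hs_def
  obtain ⟨c, hc⟩ := exists_fibredChart B (s x)
  have hpx : B.proj (s x) = x := hs.1.1 x hx
  have hxb : x ∈ c.base.source := by rw [← hpx]; exact c.proj_mem _ hc
  have hu : c.base x ∈ c.sectionDomain U s :=
    ⟨c.base.map_source hxb, by rwa [c.base.left_inv hxb], by rwa [c.base.left_inv hxb]⟩
  have hD := c.isOpen_sectionDomain hU hs.1.2.continuousOn
  have hsm : HasMFDerivAt (𝓡 n) (𝓡 (n + m)) s (c.base.symm (c.base x))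
      (mfderiv (𝓡 n) (𝓡 (n + m)) s x) := by
    rw [c.base.left_inv hxb]
    exact ((hs.1.2.contMDiffAt (hU.mem_nhds hx)).mdifferentiableAt (by simp)).hasMFDerivAt
  have hct : HasMFDerivAt (𝓡 (n + m)) 𝓘(ℝ, (Fin n → ℝ) × (Fin m → ℝ)) c.total
      (s (c.base.symm (c.base x))) (c.dTotal (s x)) := by
    rw [c.base.left_inv hxb]
    exact c.hasMFDerivAt_total hc
  let ds : EuclideanSpace ℝ (Fin n) →L[ℝ] EuclideanSpace ℝ (Fin (n + m)) :=
    mfderiv (𝓡 n) (𝓡 (n + m)) s x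
  have hcomp : HasMFDerivAt 𝓘(ℝ, Fin n → ℝ) 𝓘(ℝ, (Fin n → ℝ) × (Fin m → ℝ))
      (fun v => c.total (s (c.base.symm v))) (c.base x)
      ((c.dTotal (s x)).comp (ds.comp (c.dBaseSymm x))) :=
    hct.comp (c.base x) (hsm.comp (c.base x) (c.hasMFDerivAt_base_symm hxb))
  have hcomp' : HasFDerivAt (fun v => c.total (s (c.base.symm v)))
      ((c.dTotal (s x)).comp (ds.comp (c.dBaseSymm x))) (c.base x) :=
    hasMFDerivAt_iff_hasFDerivAt.1 hcomp
  have hb := (((hs.2 c).contDiffAt (hD.mem_nhds hu)).differentiableAt (by simp)).hasFDerivAt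
  have h2 : (fun v => (c.total (s (c.base.symm v))).1) =ᶠ[nhds (c.base x)] id := by
    filter_upwards [hD.mem_nhds hu] with v hv
    exact hs.1.total_fst hv
  have h3 := hcomp'.fst.unique ((hasFDerivAt_id _).congr_of_eventuallyEq h2)
  have h4 := hcomp'.snd.unique hb.snd.fst
  change (sbar x).2.1 = ds
  refine c.clm_ext_frame (x := B.proj (s x)) (c.proj_mem _ hc) fun l => c.dTotal_injective hc ?_
  refine (c.dTotal_jet_frame hc (sbar x).2 l).trans ?_
  have e : c.dTotal (s x) (ds (c.frame (B.proj (s x)) l))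
      = (c.dTotal (s x)).comp (ds.comp (c.dBaseSymm x)) (Pi.single l 1) := by
    rw [hpx]; rfl
  rw [e]
  refine Prod.ext ?_ ?_
  · exact (congrArg (fun f : (Fin n → ℝ) →L[ℝ] (Fin n → ℝ) => f (Pi.single l 1)) h3).symm
  · have h5 := congrArg (fun f : (Fin n → ℝ) →L[ℝ] (Fin m → ℝ) => f (Pi.single l 1)) h4
    refine Eq.trans ?_ h5.symm
    ext i
    have h6 := (hEL c (c.base x) hu).1 l i
    dsimp only at h6
    rw [c.base.left_inv hxb] at h6
    exact h6.symm

end Multimomentum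

end

open Multimomentum

theorem proposition10 {n m : ℕ} {X Y : Type*}
    [TopologicalSpace X] [T2Space X] [SecondCountableTopology X] [ConnectedSpace X]
    [ChartedSpace (EuclideanSpace ℝ (Fin n)) X] [IsManifold (𝓡 n) ∞ X]
    [TopologicalSpace Y] [T2Space Y] [SecondCountableTopology Y] [ConnectedSpace Y]
    [ChartedSpace (EuclideanSpace ℝ (Fin (n + m))) Y] [IsManifold (𝓡 (n + m)) ∞ Y]
    (B : FibredManifold n m X Y) (L : Lagrangian B) (hL : L.Semiregular)
    (H : LegendreForm B n) (hH : H.IsHamiltonian) (hHL : H.IsAssociated L)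
    (U : Set X) (hU : IsOpen U) :
    -- (i)
    (∀ r : X → Legendre B, IsLegendreSection U r → H.HamiltonEquations U r →
      (∀ x ∈ U, r x ∈ L.constraintSpace) →
        IsJetSection U (fun x => H.momentumMorphism (r x)) ∧
        FirstOrderEulerLagrange U L (fun x => H.momentumMorphism (r x))) ∧
    -- (ii)
    (∀ sbar : X → Jet B, IsJetSection U sbar → FirstOrderEulerLagrange U L sbar →
      (∀ x ∈ U, H.momentumMorphism (L.legendre (sbar x)) = sbar x) →
        IsLegendreSection U (fun x => L.legendre (sbar x)) ∧
        H.HamiltonEquations U (fun x => L.legendre (sbar x)) ∧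
        ∀ x ∈ U, L.legendre (sbar x) ∈ L.constraintSpace) ∧
    -- (iii)
    (∀ (r : X → Legendre B) (sbar : X → Jet B),
      ((IsLegendreSection U r ∧ H.HamiltonEquations U r ∧
          (∀ x ∈ U, r x ∈ L.constraintSpace) ∧
          ∀ x ∈ U, sbar x = H.momentumMorphism (r x)) ∨
        (IsJetSection U sbar ∧ FirstOrderEulerLagrange U L sbar ∧
          (∀ x ∈ U, H.momentumMorphism (L.legendre (sbar x)) = sbar x) ∧
          ∀ x ∈ U, r x = L.legendre (sbar x))) →
      IsSection B U (fun x => (r x).1) ∧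
      IsJetProlongation U (fun x => (r x).1) sbar ∧
      SecondOrderEulerLagrange U L (fun x => (r x).1)) := by
  have fwd : ∀ (r : X → Legendre B) (sbar : X → Jet B), IsLegendreSection U r →
      H.HamiltonEquations U r → (∀ x ∈ U, r x ∈ L.constraintSpace) →
      (∀ x ∈ U, sbar x = H.momentumMorphism (r x)) →
      IsJetSection U sbar ∧ FirstOrderEulerLagrange U L sbar := by
    intro r sbar hr hHam hQ hs
    have hss := hr.isJetSection hH hs
    exact ⟨hss, (hamiltonEquations_iff hH hHL hU hr hss hs fun x hx => by
      rw [hs x hx, hHL.1 _ (hQ x hx)]).1 hHam⟩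
  refine ⟨fun r hr hHam hQ => fwd r _ hr hHam hQ fun _ _ => rfl, fun sbar hs hEL hfix => ?_,
    fun r sbar h => ?_⟩
  · have hr : IsLegendreSection U (fun x => L.legendre (sbar x)) :=
      hs.isLegendreSection fun _ _ => rfl
    exact ⟨hr, (hamiltonEquations_iff hH hHL hU hr hs (fun x hx => (hfix x hx).symm)
      fun _ _ => rfl).2 hEL, fun x _ => ⟨_, rfl⟩⟩
  · have key : IsJetSection U sbar ∧ FirstOrderEulerLagrange U L sbar ∧
        ∀ x ∈ U, (r x).1 = (sbar x).1 := by
      rcases h with ⟨hr, hHam, hQ, hs⟩ | ⟨hs, hEL, -, hr⟩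
      · obtain ⟨h1, h2⟩ := fwd r sbar hr hHam hQ hs
        exact ⟨h1, h2, fun x hx => by rw [hs x hx]; rfl⟩
      · exact ⟨hs, hEL, fun x hx => by rw [hr x hx]; rfl⟩
    obtain ⟨hs, hEL, hrs⟩ := key
    exact ⟨hs.1.congr hrs, hEL.isJetProlongation hU hs hrs, hEL.secondOrder hU hs hrs⟩
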